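/- For an integer $c\ge 1$ let $f_c(x)=(x+c)\log(x+c)$ (natural logarithm), and for a finite simple graph $G$ with vertex degrees $d_1,\dots,d_n$ (isolated vertices included) let $h_c(G)=\sum_{i=1}^n f_c(d_i)$. Let $K_{1,m}=S_{m+1}$ be the star with $m$ edges, $K_n$ the complete graph on $n$ vertices, and $K_4^-$ the graph $K_4$ minus one edge. Let $m\ge 0$ be an integer. (i) Among all finite simple graphs with $m$ edges (of any order), the graphs maximizing $h_1$ are, up to isomorphism and up to adding or deleting isolated vertices, exactly the following: $K_{1,m}$ if $m\notin\{3,5,6\}$; $K_3$ if $m=3$; $K_4^-$ and $S_6=K_{1,5}$ if $m=5$; $K_4$ if $m=6$. (ii) For all integers $c\ge 2$ and $n>m$, among all simple graphs with $m$ edges and exactly $n$ vertices, the graphs maximizing $h_c$ are, up to isomorphism and disregarding isolated vertices, exactly the following: $K_{1,m}$ if $m\ne 3$; $K_3$ if $m=3$. -/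

import Mathlib

universe u

namespace DegreeEntropy

/-- The function `f_c(x) = (x + c) log (x + c)` (natural logarithm). -/
noncomputable def f (c x : ℝ) : ℝ := (x + c) * Real.log (x + c)

open Classical in
/-- `h_c(G) = ∑ f_c(d_i)`, the sum being over all vertices, isolated ones included. -/
noncomputable def h (c : ℝ) {V : Type u} [Fintype V] (G : SimpleGraph V) : ℝ :=
  ∑ v : V, f c (G.degree v)

/-- The number of edges of `G`. -/
noncomputable def size {V : Type u} (G : SimpleGraph V) : ℕ := G.edgeSet.ncard

/-- `G` has `m` edges and maximizes `h_c` among all finite graphs, of any order, with `m` edges. -/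
def MaximizesGivenSize (c : ℝ) (m : ℕ) {V : Type u} [Fintype V] (G : SimpleGraph V) : Prop :=
  size G = m ∧
    ∀ (W : Type u) [Fintype W] (H : SimpleGraph W), size H = m → h c H ≤ h c G

/-- `G` has `m` edges and maximizes `h_c` among all graphs with `m` edges and as many vertices
as `G`. -/
def MaximizesGivenOrderAndSize (c : ℝ) (m : ℕ) {V : Type u} [Fintype V]
    (G : SimpleGraph V) : Prop :=
  size G = m ∧ ∀ H : SimpleGraph V, size H = m → h c H ≤ h c G

/-- `G` and `H` are isomorphic once the isolated vertices of both are omitted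
(`G.support` is the set of non-isolated vertices). -/
def EqUpToIsolated {V W : Type*} (G : SimpleGraph V) (H : SimpleGraph W) : Prop :=
  Nonempty (G.induce G.support ≃g H.induce H.support)

/-- The star `K_{1,m} = S_{m+1}`. -/
abbrev star (m : ℕ) : SimpleGraph (Fin 1 ⊕ Fin m) := completeBipartiteGraph (Fin 1) (Fin m)

/-- The complete graph `K_n`. -/
abbrev K (n : ℕ) : SimpleGraph (Fin n) := ⊤

/-- `K_4^-`, the complete graph on four vertices minus one edge. -/
abbrev K4minus : SimpleGraph (Fin 4) := (K 4).deleteEdges {s(0, 1)}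

end DegreeEntropy

/-! Case c = 1. Since f_1(0) = 0, isolated vertices do not count, and one argues by induction on m.
A vertex of degree m forces a star. If some vertex v has degree d with 4 ≤ d < m, delete it and let
k = m - d. The neighbours of v lose the increments (a+1)log(a+1) - a log a of their degrees a. These
are concave in a, and the neighbour degrees sum to at most d + 2k, so Jensen bounds the loss
(`h_one_le_removeVertex`). Measured against stars, the bound is `removalGap d k`, which is negative
(`removalGap_neg`). When the remainder may beat its star, namely as K_3 or K_4, the gap still
absorbs the excess. If all degrees are at most 3, then f_1(d) ≤ (8/3)d log 2, so h_1 ≤ (16/3)m log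
2, which is below the star for m ≥ 7. The smaller m are settled by sharper linear bounds, whose
equality cases are K_3, K_4^- and K_4.

Case c ≥ 2. Summation by parts writes "star minus G" as ∑_j a_j w_c(j). Here w_c(j) is the second
difference of x log x at c + j, and a_j depends only on the degrees. The a_j change sign at most
once, from negative to nonnegative (`gapCoeff_nonneg_of_le`), while w_{c+1}(j)/w_c(j) increases
strictly in j (`secondDiff_ratio_strictMono`). Hence a non-star that does not exceed the star at c
lies strictly below it at c + 1 (`starGap_add_one_pos`). The result for c = 1 thus propagates: the
tie K_4^- drops out, K_4 falls below the star already at c = 2, and only K_3 stays above for every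
c. -/

namespace DegreeEntropy

/-! ### Degree sums, and recognizing stars, K_n and K_4^- up to isolated vertices -/

variable {V W : Type*}

open Classical in
/-- The degree of a vertex, with no decidability assumptions. -/
noncomputable def deg [Fintype V] (G : SimpleGraph V) (v : V) : ℕ := G.degree v

theorem deg_eq_degree [Fintype V] (G : SimpleGraph V) (v : V) [Fintype (G.neighborSet v)] :
    deg G v = G.degree v := by
  unfold deg
  congr!

/-- The sum of `F` over the degrees of `G`. -/
noncomputable def degSum [Fintype V] (F : ℕ → ℝ) (G : SimpleGraph V) : ℝ := ∑ v, F (deg G v)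

theorem h_eq_degSum {V : Type u} [Fintype V] (c : ℝ) (G : SimpleGraph V) :
    h c G = degSum (fun d => f c d) G := rfl

theorem sum_deg [Fintype V] (G : SimpleGraph V) : ∑ v, deg G v = 2 * size G := by
  classical
  simp_rw [deg_eq_degree, SimpleGraph.sum_degrees_eq_twice_card_edges]
  rw [size, ← SimpleGraph.coe_edgeFinset, Set.ncard_coe_finset]

theorem degSum_natCast [Fintype V] (G : SimpleGraph V) :
    degSum (fun d => (d : ℝ)) G = 2 * size G := by
  have := sum_deg G
  rw [degSum]
  exact_mod_cast this

theorem deg_pos_of_adj [Fintype V] {G : SimpleGraph V} {v w : V} (hvw : G.Adj v w) :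
    0 < deg G v := by
  classical
  rw [deg_eq_degree]
  exact hvw.degree_pos_left

theorem deg_eq_zero_iff [Fintype V] {G : SimpleGraph V} {v : V} :
    deg G v = 0 ↔ v ∉ G.support := by
  classical
  rw [deg_eq_degree, SimpleGraph.degree_eq_zero_iff_notMem_support]

theorem deg_le_size [Fintype V] (G : SimpleGraph V) (v : V) : deg G v ≤ size G := by
  classical
  rw [deg_eq_degree, size, ← SimpleGraph.coe_edgeFinset, Set.ncard_coe_finset]
  exact SimpleGraph.degree_le_card_edgeFinset ..

theorem deg_iso [Fintype V] [Fintype W] {G : SimpleGraph V} {H : SimpleGraph W} (e : G ≃g H)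
    (v : V) : deg H (e v) = deg G v := by
  classical
  rw [deg_eq_degree, deg_eq_degree, e.degree_eq]

open Classical in
theorem deg_induce_support [Fintype V] (G : SimpleGraph V) (x : G.support) :
    deg (G.induce G.support) x = deg G x := by
  rw [deg_eq_degree, deg_eq_degree, ← SimpleGraph.card_neighborFinset_eq_degree,
    ← SimpleGraph.card_neighborFinset_eq_degree]
  refine Finset.card_bij (fun y _ => (y : V)) ?_ ?_ ?_
  · intro y hy
    simpa using hy
  · intro a _ b _ hab
    exact Subtype.ext hab
  · intro b hb
    have hb' : G.Adj x b := by simpa using hb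
    exact ⟨⟨b, x, hb'.symm⟩, by simpa using hb', rfl⟩

open Classical in
theorem degSum_induce_support [Fintype V] (G : SimpleGraph V) {F : ℕ → ℝ} (hF : F 0 = 0) :
    degSum F (G.induce G.support) = degSum F G := by
  unfold degSum
  simp_rw [deg_induce_support]
  rw [← Finset.sum_subset (Finset.subset_univ (Finset.univ.filter fun v => v ∈ G.support))]
  · exact (Finset.sum_subtype _ (by simp) fun v => F (deg G v)).symm
  · intro v _ hv
    rw [deg_eq_zero_iff.2 (by simpa using hv), hF]

theorem EqUpToIsolated.degSum_eq [Fintype V] [Fintype W] {G : SimpleGraph V} {H : SimpleGraph W}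
    (e : EqUpToIsolated G H) {F : ℕ → ℝ} (hF : F 0 = 0) : degSum F G = degSum F H := by
  classical
  obtain ⟨e⟩ := e
  rw [← degSum_induce_support G hF, ← degSum_induce_support H hF]
  exact Fintype.sum_equiv e.toEquiv _ _ fun v => by rw [← deg_iso e v]; rfl

theorem EqUpToIsolated.size_eq [Fintype V] [Fintype W] {G : SimpleGraph V} {H : SimpleGraph W}
    (e : EqUpToIsolated G H) : size G = size H := by
  have h := e.degSum_eq (F := fun d => (d : ℝ)) (by simp)
  rw [degSum_natCast, degSum_natCast] at h
  have : (size G : ℝ) = size H := by linarith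
  exact_mod_cast this

theorem eqUpToIsolated_map (H : SimpleGraph W) (e : W ↪ V) : EqUpToIsolated (H.map e) H := by
  have hs : ∀ w : W, w ∈ H.support → e w ∈ (H.map e).support := by
    rintro w ⟨x, hx⟩
    exact ⟨e x, by simpa using hx⟩
  let g : H.support → (H.map e).support := fun w => ⟨e w, hs w w.2⟩
  have hg : Function.Bijective g := by
    constructor
    · intro a b hab
      exact Subtype.ext (e.injective (congrArg Subtype.val hab))
    · rintro ⟨b, c, hbc⟩
      have hbc' : (H.map e).Adj b c := hbc
      rw [SimpleGraph.map_adj] at hbc'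
      obtain ⟨x, y, hxy, rfl, rfl⟩ := hbc'
      exact ⟨⟨x, y, hxy⟩, rfl⟩
  refine ⟨RelIso.symm ⟨Equiv.ofBijective g hg, ?_⟩⟩
  intro a b
  simp [g]

/-- A graph whose edges lie within the range of an embedding is the image of its pullback. -/
theorem map_comap_of_support_subset (G : SimpleGraph V) (e : W ↪ V)
    (he : G.support ⊆ Set.range e) : (G.comap e).map e = G := by
  ext a b
  rw [SimpleGraph.map_adj]
  constructor
  · rintro ⟨x, y, hxy, rfl, rfl⟩
    exact hxy
  · intro hab
    obtain ⟨x, rfl⟩ := he ⟨b, hab⟩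
    obtain ⟨y, rfl⟩ := he ⟨_, hab.symm⟩
    exact ⟨x, y, hab, rfl, rfl⟩

theorem exists_map_of_support_subset {n : ℕ} (G : SimpleGraph V) (S : Finset V)
    (hS : S.card = n) (h : G.support ⊆ S) :
    ∃ (e : Fin n ↪ V) (H : SimpleGraph (Fin n)), G = H.map e := by
  let e : Fin n ↪ V := (S.equivFinOfCardEq hS).symm.toEmbedding.trans (Function.Embedding.subtype _)
  refine ⟨e, G.comap e, (map_comap_of_support_subset G e ?_).symm⟩
  intro v hv
  exact ⟨S.equivFinOfCardEq hS ⟨v, h hv⟩, by simp [e]⟩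

theorem size_add_size_compl {n : ℕ} (H : SimpleGraph (Fin n)) :
    size H + size Hᶜ = n.choose 2 := by
  classical
  have h1 := sum_deg H
  have h2 := sum_deg Hᶜ
  have h3 : ∀ v, deg H v + deg Hᶜ v = n - 1 := by
    intro v
    have := H.degree_lt_card_verts v
    rw [deg_eq_degree, deg_eq_degree, SimpleGraph.degree_compl]
    simp only [Fintype.card_fin] at *
    omega
  have h4 : ∑ v, deg H v + ∑ v, deg Hᶜ v = n * (n - 1) := by
    rw [← Finset.sum_add_distrib, Finset.sum_congr rfl fun v _ => h3 v]
    simp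
  rw [Nat.choose_two_right]
  omega

theorem eqUpToIsolated_K {n : ℕ} [Fintype V] (G : SimpleGraph V) (S : Finset V)
    (hS : S.card = n) (h : G.support ⊆ S) (hG : size G = n.choose 2) : EqUpToIsolated G (K n) := by
  obtain ⟨e, H, rfl⟩ := exists_map_of_support_subset G S hS h
  have h1 := size_add_size_compl H
  rw [(eqUpToIsolated_map H e).size_eq] at hG
  have h2 : size Hᶜ = 0 := by omega
  rw [size, Set.ncard_eq_zero, SimpleGraph.edgeSet_eq_empty] at h2
  have h3 : H = ⊤ := by rwa [compl_eq_bot] at h2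
  rw [h3]
  exact eqUpToIsolated_map _ e

theorem eqUpToIsolated_K4minus [Fintype V] (G : SimpleGraph V) (S : Finset V)
    (hS : S.card = 4) (h : G.support ⊆ S) (hG : size G = 5) : EqUpToIsolated G K4minus := by
  obtain ⟨e, H, rfl⟩ := exists_map_of_support_subset G S hS h
  have h1 := size_add_size_compl H
  rw [(eqUpToIsolated_map H e).size_eq] at hG
  have h2 : size Hᶜ = 1 := by
    have : Nat.choose 4 2 = 6 := rfl
    omega
  rw [size, Set.ncard_eq_one] at h2
  obtain ⟨p, hp⟩ := h2
  induction p using Sym2.ind with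
  | _ x y =>
  have hadj : ∀ a b, Hᶜ.Adj a b ↔ s(a, b) = s(x, y) := by
    intro a b
    rw [← SimpleGraph.mem_edgeSet, hp, Set.mem_singleton_iff]
  have hxy : x ≠ y := ((hadj x y).2 rfl).ne
  -- The complement is the single edge xy; σ carries the pair 0, 1 missing from the model `K4minus`
  -- onto it.
  obtain ⟨σ, hσ0, hσ1⟩ : ∃ σ : Equiv.Perm (Fin 4), σ 0 = x ∧ σ 1 = y := by
    clear hadj hp
    revert x y
    decide
  have hH : H = K4minus.map σ.toEmbedding := by
    ext a b
    obtain ⟨a, rfl⟩ := σ.surjective a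
    obtain ⟨b, rfl⟩ := σ.surjective b
    have h5 := hadj (σ a) (σ b)
    have h6 : (K4minus.map σ.toEmbedding).Adj (σ a) (σ b) ↔ K4minus.Adj a b :=
      SimpleGraph.map_adj_apply (f := σ.toEmbedding)
    rw [h6]
    rw [← hσ0, ← hσ1] at h5
    simp only [SimpleGraph.compl_adj, ne_eq, EmbeddingLike.apply_eq_iff_eq, Sym2.eq_iff] at h5
    simp only [K4minus, SimpleGraph.deleteEdges_adj, SimpleGraph.top_adj, Set.mem_singleton_iff,
      Sym2.eq_iff]
    have h7 : H.Adj (σ a) (σ b) → a ≠ b := fun hh hab => hh.ne (by rw [hab])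
    tauto
  rw [hH, SimpleGraph.map_map]
  exact eqUpToIsolated_map _ (σ.toEmbedding.trans e)

/-- The vertices other than v have total degree equal to the number of neighbours of v, which each
neighbour's edge to v already accounts for. An edge avoiding v would exceed this total. -/
theorem eqUpToIsolated_star [Fintype V] (G : SimpleGraph V) (v : V) (hv : deg G v = size G) :
    EqUpToIsolated G (star (size G)) := by
  classical
  have hsum := sum_deg G
  have hN : (G.neighborFinset v).card = size G := by
    rw [← hv, deg_eq_degree, SimpleGraph.card_neighborFinset_eq_degree]
  have hvN : v ∉ G.neighborFinset v := by simp
  have hedge : ∀ a b, G.Adj a b → a = v ∨ b = v := by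
    by_contra! hcon
    obtain ⟨a, b, hab, hav, hbv⟩ := hcon
    have h1 : ∀ w ∈ Finset.univ.erase v, (if w ∈ G.neighborFinset v then 1 else 0) ≤ deg G w := by
      intro w _
      split_ifs with hw
      · exact deg_pos_of_adj ((G.mem_neighborFinset v w).1 hw).symm
      · exact Nat.zero_le _
    have h2 : (if a ∈ G.neighborFinset v then 1 else 0) < deg G a := by
      split_ifs with ha
      · rw [deg_eq_degree, ← SimpleGraph.card_neighborFinset_eq_degree, Finset.one_lt_card]
        exact ⟨v, by simpa [SimpleGraph.adj_comm] using ha, b, by simpa using hab, hbv.symm⟩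
      · exact deg_pos_of_adj hab
    have h3 := Finset.sum_lt_sum h1 ⟨a, by simp [hav], h2⟩
    rw [← Finset.add_sum_erase _ _ (Finset.mem_univ v), hv] at hsum
    have h4 : ∑ w ∈ Finset.univ.erase v, (if w ∈ G.neighborFinset v then 1 else 0) = size G := by
      rw [← hN, Finset.sum_ite_mem, Finset.card_eq_sum_ones]
      congr 1
      ext w
      simp only [Finset.mem_inter, Finset.mem_erase, Finset.mem_univ, and_true,
        and_iff_right_iff_imp]
      rintro hw rfl
      exact hvN hw
    omega
  let ι := (G.neighborFinset v).equivFinOfCardEq hN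
  have hι : ∀ i, G.Adj v (ι.symm i) := fun i => by
    simpa only [SimpleGraph.mem_neighborFinset] using (ι.symm i).2
  let e : Fin 1 ⊕ Fin (size G) ↪ V :=
    ⟨Sum.elim (fun _ => v) (fun i => (ι.symm i : V)), by
      rintro (i | i) (j | j) hij
      · exact congrArg _ (Subsingleton.elim _ _)
      · simp only [Sum.elim_inl, Sum.elim_inr] at hij
        exact absurd hij (hι j).ne
      · simp only [Sum.elim_inl, Sum.elim_inr] at hij
        exact absurd hij (hι i).ne'
      · simp only [Sum.elim_inr] at hij
        rw [ι.symm.injective (Subtype.ext hij)]⟩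
  have key : ∀ b, G.Adj v b → ((star (size G)).map e).Adj v b := by
    intro b hb
    rw [SimpleGraph.map_adj]
    refine ⟨Sum.inl 0, Sum.inr (ι ⟨b, by simpa using hb⟩), by simp, rfl, ?_⟩
    change ((ι.symm (ι _) : G.neighborFinset v) : V) = b
    rw [Equiv.symm_apply_apply]
  have hG : G = (star (size G)).map e := by
    ext a b
    constructor
    · intro hab
      rcases hedge a b hab with rfl | rfl
      · exact key b hab
      · exact (key a hab.symm).symm
    · rw [SimpleGraph.map_adj]
      rintro ⟨i | i, j | j, hij, rfl, rfl⟩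
      · simp at hij
      · exact hι j
      · exact (hι i).symm
      · simp at hij
  conv_lhs => rw [hG]
  exact eqUpToIsolated_map _ e

theorem degSum_star (m : ℕ) (F : ℕ → ℝ) : degSum F (star m) = F m + m * F 1 := by
  classical
  have h1 : ∀ i, deg (star m) (Sum.inl i) = m := by
    intro i
    rw [deg_eq_degree, ← SimpleGraph.card_neighborFinset_eq_degree]
    have : (star m).neighborFinset (Sum.inl i) = Finset.univ.map Function.Embedding.inr := by
      ext (a | a) <;> simp
    rw [this]
    simp
  have h2 : ∀ i, deg (star m) (Sum.inr i) = 1 := by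
    intro i
    rw [deg_eq_degree, ← SimpleGraph.card_neighborFinset_eq_degree]
    have : (star m).neighborFinset (Sum.inr i) = Finset.univ.map Function.Embedding.inl := by
      ext (a | a) <;> simp [Fin.fin_one_eq_zero]
    rw [this]
    simp
  simp [degSum, h1, h2]

theorem degSum_K (n : ℕ) (F : ℕ → ℝ) : degSum F (K n) = n * F (n - 1) := by
  classical
  have h1 : ∀ i, deg (K n) i = n - 1 := by
    intro i
    rw [deg_eq_degree]
    simp
  simp [degSum, h1]

theorem degSum_K4minus (F : ℕ → ℝ) : degSum F K4minus = 2 * F 2 + 2 * F 3 := by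
  classical
  have h1 : ∀ i, deg K4minus i = ![2, 2, 3, 3] i := by
    intro i
    rw [deg_eq_degree, ← SimpleGraph.card_neighborFinset_eq_degree]
    have : K4minus.neighborFinset i =
        ![{2, 3}, {2, 3}, {0, 1, 3}, {0, 1, 2}] i := by
      ext j
      rw [SimpleGraph.mem_neighborFinset, SimpleGraph.deleteEdges_adj]
      revert i j
      simp only [SimpleGraph.top_adj, Set.mem_singleton_iff]
      decide
    rw [this]
    revert i
    decide
  simp [degSum, h1, Fin.sum_univ_four]
  ring

theorem size_of_degSum [Fintype V] {G : SimpleGraph V} {m : ℕ}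
    (hG : degSum (fun d => (d : ℝ)) G = 2 * m) : size G = m := by
  rw [degSum_natCast] at hG
  have : (size G : ℝ) = m := by linarith
  exact_mod_cast this

theorem size_star (m : ℕ) : size (star m) = m := by
  apply size_of_degSum
  rw [degSum_star]
  push_cast
  ring

theorem size_K_three : size (K 3) = 3 := by
  apply size_of_degSum
  rw [degSum_K]
  norm_num

theorem size_K_four : size (K 4) = 6 := by
  apply size_of_degSum
  rw [degSum_K]
  norm_num

theorem size_K4minus : size K4minus = 5 := by
  apply size_of_degSum
  rw [degSum_K4minus]
  norm_num

end DegreeEntropy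

/-! ### Vertex removal and the Jensen bound -/

namespace DegreeEntropy

variable {V W : Type*}

/-- The graph `G` with all edges at `v` deleted. -/
def removeVertex (G : SimpleGraph V) (v : V) : SimpleGraph V where
  Adj a b := G.Adj a b ∧ a ≠ v ∧ b ≠ v
  symm := ⟨fun _ _ h => ⟨h.1.symm, h.2.2, h.2.1⟩⟩
  loopless := ⟨fun _ h => h.1.ne rfl⟩

theorem removeVertex_adj {G : SimpleGraph V} {v a b : V} :
    (removeVertex G v).Adj a b ↔ G.Adj a b ∧ a ≠ v ∧ b ≠ v := Iff.rfl

open Classical in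
theorem deg_removeVertex [Fintype V] (G : SimpleGraph V) (v w : V) :
    deg (removeVertex G v) w =
      if w = v then 0 else if G.Adj v w then deg G w - 1 else deg G w := by
  split_ifs with h1 h2
  · rw [deg_eq_zero_iff]
    rintro ⟨x, hx⟩
    exact hx.2.1 h1
  · simp only [deg_eq_degree, ← SimpleGraph.card_neighborFinset_eq_degree]
    rw [← Finset.card_erase_of_mem (by simpa using h2.symm : v ∈ G.neighborFinset w)]
    congr 1
    ext x
    simp only [SimpleGraph.mem_neighborFinset, removeVertex_adj, Finset.mem_erase]
    tauto
  · simp only [deg_eq_degree, ← SimpleGraph.card_neighborFinset_eq_degree]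
    congr 1
    ext x
    simp only [SimpleGraph.mem_neighborFinset, removeVertex_adj]
    refine ⟨fun h => h.1, fun h => ⟨h, h1, ?_⟩⟩
    rintro rfl
    exact h2 h.symm

open Classical in
theorem degSum_removeVertex [Fintype V] (G : SimpleGraph V) (v : V) (F : ℕ → ℝ) :
    degSum F G = F (deg G v) - F 0 +
      ∑ w ∈ G.neighborFinset v, (F (deg G w) - F (deg G w - 1)) + degSum F (removeVertex G v) := by
  have h : ∀ w, F (deg G w) = (if w = v then F (deg G v) - F 0 else 0) +
      (if w ∈ G.neighborFinset v then F (deg G w) - F (deg G w - 1) else 0) +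
      F (deg (removeVertex G v) w) := by
    intro w
    rw [deg_removeVertex]
    simp only [SimpleGraph.mem_neighborFinset]
    by_cases h1 : w = v
    · subst h1
      simp
    · by_cases h2 : G.Adj v w <;> simp [h1, h2]
  unfold degSum
  rw [Finset.sum_congr rfl fun w _ => h w, Finset.sum_add_distrib, Finset.sum_add_distrib,
    Finset.sum_ite_mem, Finset.sum_ite_eq', Finset.univ_inter, if_pos (Finset.mem_univ v)]

open Classical in
theorem card_neighborFinset_eq_deg [Fintype V] (G : SimpleGraph V) (v : V) :
    (G.neighborFinset v).card = deg G v := by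
  rw [deg_eq_degree, SimpleGraph.card_neighborFinset_eq_degree]

open Classical in
theorem size_removeVertex [Fintype V] (G : SimpleGraph V) (v : V) :
    size G = deg G v + size (removeVertex G v) := by
  have h := degSum_removeVertex G v fun d => (d : ℝ)
  have h1 : ∑ w ∈ G.neighborFinset v, ((deg G w : ℝ) - ((deg G w - 1 : ℕ) : ℝ)) = deg G v := by
    rw [← card_neighborFinset_eq_deg, Finset.card_eq_sum_ones, Nat.cast_sum]
    refine Finset.sum_congr rfl fun w hw => ?_
    have : 0 < deg G w := deg_pos_of_adj ((G.mem_neighborFinset v w).1 hw).symm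
    rw [Nat.cast_sub this]
    simp
  rw [h1, degSum_natCast, degSum_natCast] at h
  have : (size G : ℝ) = deg G v + size (removeVertex G v) := by
    push_cast at h
    linarith
  exact_mod_cast this

open Classical in
theorem deg_add_sum_neighbor_add_sum [Fintype V] (G : SimpleGraph V) (v : V) :
    deg G v + ∑ w ∈ G.neighborFinset v, deg G w +
      ∑ w ∈ Finset.univ \ insert v (G.neighborFinset v), deg G w = 2 * size G := by
  rw [← sum_deg, ← Finset.sum_insert (by simp), add_comm]
  exact Finset.sum_sdiff (Finset.subset_univ _)

/-- If the degrees around `v` exhaust the degree sum, then all edges lie in the closed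
neighbourhood of `v`. -/
theorem support_subset_of_sum_neighbor [Fintype V] (G : SimpleGraph V) (v : V) (S : Finset V)
    (hS : ∀ w, w ∈ S ↔ G.Adj v w)
    (h : 2 * size G ≤ deg G v + ∑ w ∈ S, deg G w) :
    ∃ T : Finset V, T.card = deg G v + 1 ∧ G.support ⊆ T := by
  classical
  have hS' : S = G.neighborFinset v := by
    ext w
    simp [hS]
  subst hS'
  refine ⟨insert v (G.neighborFinset v), ?_, ?_⟩
  · rw [Finset.card_insert_of_notMem (by simp), card_neighborFinset_eq_deg]
  · have h1 := deg_add_sum_neighbor_add_sum G v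
    have h2 : ∑ w ∈ Finset.univ \ insert v (G.neighborFinset v), deg G w = 0 := by omega
    rw [Finset.sum_eq_zero_iff] at h2
    intro w hw
    by_contra hcon
    exact deg_eq_zero_iff.1 (h2 w (by simpa using hcon)) hw

/-- A form of the log-sum inequality: the tangent to `a ↦ (a + 1) log (a + 1) - a log a`. -/
theorem mul_log_increment_le {a b : ℝ} (ha : 0 < a) (hb : 0 < b) :
    (a + 1) * Real.log (a + 1) - a * Real.log a ≤
      (a + 1) * Real.log (b + 1) - a * Real.log b := by
  have h1 : Real.log (b * (a + 1) / (a * (b + 1))) =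
      Real.log b + Real.log (a + 1) - (Real.log a + Real.log (b + 1)) := by
    rw [Real.log_div (by positivity) (by positivity), Real.log_mul (by positivity) (by positivity),
      Real.log_mul (by positivity) (by positivity)]
  have h2 : Real.log ((a + 1) / (b + 1)) = Real.log (a + 1) - Real.log (b + 1) :=
    Real.log_div (by positivity) (by positivity)
  -- The bound log t ≤ t - 1 is used twice, with weights a and 1; by `h5` the weighted right-hand
  -- sides cancel.
  have h3 := Real.log_le_sub_one_of_pos (show 0 < b * (a + 1) / (a * (b + 1)) by positivity)
  have h4 := Real.log_le_sub_one_of_pos (show 0 < (a + 1) / (b + 1) by positivity)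
  have h5 : a * (b * (a + 1) / (a * (b + 1)) - 1) + ((a + 1) / (b + 1) - 1) = 0 := by
    field_simp
    ring
  have h6 := mul_le_mul_of_nonneg_left h3 ha.le
  rw [h1] at h6
  rw [h2] at h4
  nlinarith

theorem f_one (n : ℕ) : f 1 n = ((n : ℝ) + 1) * Real.log (n + 1) := rfl

theorem f_one_pred {n : ℕ} (hn : 0 < n) : f 1 (n - 1 : ℕ) = (n : ℝ) * Real.log n := by
  rw [f_one, Nat.cast_sub hn]
  simp

open Classical in
/-- The bound on `h_1` obtained by deleting a vertex of degree `d` and applying Jensen's inequality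
to its neighbours. -/
theorem h_one_le_removeVertex {V : Type u} [Fintype V] (G : SimpleGraph V) (v : V) {d k : ℕ}
    (hd : deg G v = d) (hd0 : 0 < d) (hk : size G = d + k) :
    h 1 G ≤ ((d : ℝ) + 1) * Real.log (d + 1) + 2 * (d + k) * Real.log (2 * (d + k)) -
      (d + 2 * k) * Real.log (d + 2 * k) - d * Real.log d + h 1 (removeVertex G v) := by
  have h1 := degSum_removeVertex G v fun d => f 1 d
  rw [← h_eq_degSum, ← h_eq_degSum] at h1
  have h2 := deg_add_sum_neighbor_add_sum G v
  have hd1 : (0 : ℝ) < d := by exact_mod_cast hd0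
  have hk0 : (0 : ℝ) ≤ k := Nat.cast_nonneg k
  set S : ℕ := ∑ w ∈ G.neighborFinset v, deg G w with hSdef
  have hS : (S : ℝ) ≤ d + 2 * k := by
    have : S ≤ d + 2 * k := by omega
    exact_mod_cast this
  -- The largest possible mean degree of the neighbours. Tangents are taken at b rather than at the
  -- true mean; their slope is nonnegative, so S may then be replaced by d + 2k.
  set b : ℝ := (d + 2 * k) / d with hb
  have hb0 : 0 < b := by positivity
  have hb1 : b + 1 = 2 * (d + k) / d := by
    rw [hb]
    field_simp
    ring
  have h3 : ∑ w ∈ G.neighborFinset v, (f 1 (deg G w) - f 1 (deg G w - 1 : ℕ)) ≤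
      ∑ w ∈ G.neighborFinset v, ((deg G w : ℝ) * (Real.log (b + 1) - Real.log b) +
        Real.log (b + 1)) := by
    refine Finset.sum_le_sum fun w hw => ?_
    have hw0 : 0 < deg G w := deg_pos_of_adj ((G.mem_neighborFinset v w).1 hw).symm
    rw [f_one_pred hw0, f_one]
    have := mul_log_increment_le (show (0 : ℝ) < deg G w by exact_mod_cast hw0) hb0
    linarith
  have h4 : ∑ w ∈ G.neighborFinset v, ((deg G w : ℝ) * (Real.log (b + 1) - Real.log b) +
        Real.log (b + 1)) = S * (Real.log (b + 1) - Real.log b) + d * Real.log (b + 1) := by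
    rw [Finset.sum_add_distrib, ← Finset.sum_mul, hSdef, Nat.cast_sum, Finset.sum_const,
      card_neighborFinset_eq_deg, hd, nsmul_eq_mul]
  have h5 : 0 ≤ Real.log (b + 1) - Real.log b :=
    sub_nonneg.2 (Real.log_le_log hb0 (by linarith))
  have h6 := mul_le_mul_of_nonneg_right hS h5
  have h7 : Real.log (b + 1) = Real.log (2 * (d + k)) - Real.log d := by
    rw [hb1, Real.log_div (by positivity) (by positivity)]
  have h8 : Real.log b = Real.log (d + 2 * k) - Real.log d := by
    rw [hb, Real.log_div (by positivity) (by positivity)]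
  have h9 : f 1 ((0 : ℕ) : ℝ) = 0 := by simp [f]
  rw [h9, hd, f_one d] at h1
  rw [h4] at h3
  rw [h7, h8] at h3 h6
  have h10 : ((d : ℝ) + 2 * k) * (Real.log (2 * (d + k)) - Real.log d -
      (Real.log (d + 2 * k) - Real.log d)) + d * (Real.log (2 * (d + k)) - Real.log d) =
      2 * (d + k) * Real.log (2 * (d + k)) -
      (d + 2 * k) * Real.log (d + 2 * k) - d * Real.log d := by ring
  linarith

end DegreeEntropy

/-! ### Negativity of the vertex-removal gap -/

namespace DegreeEntropy

/-- `h_1` of the star with `m` edges. -/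
noncomputable def starValue (m : ℕ) : ℝ := ((m : ℝ) + 1) * Real.log (m + 1) + 2 * m * Real.log 2

/-- The value of the vertex-removal bound minus that of the star, when the removed vertex has degree
`d` and the remaining `k` edges form a star. -/
noncomputable def removalGap (d k : ℝ) : ℝ :=
  (d + 1) * Real.log (d + 1) - d * Real.log d + 2 * ((d + k) * Real.log (d + k)) -
    (d + k + 1) * Real.log (d + k + 1) - (d + 2 * k) * Real.log (d + 2 * k) +
    (k + 1) * Real.log (k + 1) + 2 * k * Real.log 2

theorem hasDerivAt_mul_log_comp {g : ℝ → ℝ} {g' x : ℝ} (hg : HasDerivAt g g' x) (h0 : 0 < g x) :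
    HasDerivAt (fun y => g y * Real.log (g y)) ((Real.log (g x) + 1) * g') x :=
  (Real.hasDerivAt_mul_log h0.ne').comp x hg

theorem removalGap_antitoneOn_left {k : ℝ} (hk : 0 ≤ k) :
    AntitoneOn (fun d => removalGap d k) (Set.Ici 1) := by
  have hder : ∀ d : ℝ, 1 ≤ d → HasDerivAt (fun d => removalGap d k)
      (Real.log (d + 1) - Real.log d + 2 * Real.log (d + k) - Real.log (d + k + 1) -
        Real.log (d + 2 * k)) d := by
    intro d hd
    have i := hasDerivAt_id' d
    have h1 := hasDerivAt_mul_log_comp (i.add_const 1) (by linarith)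
    have h2 := hasDerivAt_mul_log_comp i (by linarith)
    have h3 := hasDerivAt_mul_log_comp (i.add_const k) (by linarith)
    have h4 := hasDerivAt_mul_log_comp ((i.add_const k).add_const 1) (by linarith)
    have h5 := hasDerivAt_mul_log_comp (i.add_const (2 * k)) (by linarith)
    have h6 := (((((h1.sub h2).add (h3.const_mul 2)).sub h4).sub h5).add_const
      ((k + 1) * Real.log (k + 1))).add_const (2 * k * Real.log 2)
    exact h6.congr_deriv (by ring)
  refine antitoneOn_of_deriv_nonpos (convex_Ici 1)
    (fun d hd => (hder d hd).continuousAt.continuousWithinAt)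
    (fun d hd => (hder d (interior_subset hd)).differentiableAt.differentiableWithinAt) ?_
  intro d hd
  have hd1 : 1 ≤ d := interior_subset hd
  rw [(hder d hd1).deriv]
  -- The exponentiated sign condition on the derivative. The right side minus the left is kd² + (d -
  -- 1)k², which is where d ≥ 1 enters.
  have key : (d + 1) * (d + k) ^ 2 ≤ d * (d + k + 1) * (d + 2 * k) := by
    nlinarith [mul_nonneg hk (show 0 ≤ d by linarith), mul_nonneg hk hk,
      mul_nonneg (mul_nonneg hk hk) (show 0 ≤ d - 1 by linarith),
      mul_nonneg hk (mul_nonneg (show 0 ≤ d by linarith) (show 0 ≤ d by linarith))]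
  have hlog := Real.log_le_log (by positivity) key
  rw [Real.log_mul (by positivity) (by positivity), Real.log_pow,
    Real.log_mul (by positivity) (by positivity), Real.log_mul (by positivity) (by positivity)]
    at hlog
  push_cast at hlog
  linarith

theorem removalGap_four_strictAntiOn : StrictAntiOn (fun k => removalGap 4 k) (Set.Ici 0) := by
  have hder : ∀ k : ℝ, 0 ≤ k → HasDerivAt (fun k => removalGap 4 k)
      (2 * Real.log (4 + k) - Real.log (4 + k + 1) - 2 * Real.log (4 + 2 * k) + Real.log (k + 1) +
        2 * Real.log 2) k := by
    intro k hk
    have i := hasDerivAt_id' k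
    have h3 := hasDerivAt_mul_log_comp (i.const_add 4) (by linarith)
    have h4 := hasDerivAt_mul_log_comp ((i.const_add 4).add_const 1) (by linarith)
    have h5 := hasDerivAt_mul_log_comp ((i.const_mul 2).const_add 4) (by linarith)
    have h1 := hasDerivAt_mul_log_comp (i.add_const 1) (by linarith)
    have h6 := (((((h3.const_mul 2).const_add ((4 + 1) * Real.log (4 + 1) - 4 * Real.log 4)).sub
      h4).sub h5).add h1).add ((i.const_mul 2).mul_const (Real.log 2))
    exact h6.congr_deriv (by ring)
  refine strictAntiOn_of_deriv_neg (convex_Ici 0)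
    (fun d hd => (hder d hd).continuousAt.continuousWithinAt) ?_
  intro k hk
  have hk0 : 0 ≤ k := interior_subset hk
  rw [(hder k hk0).deriv]
  -- The two cubics differ by the constant 16. With 3 in place of 4 the inequality reverses for k >
  -- 0, so vertices of degree 3 need a separate treatment.
  have key : (k + 1) * (4 + k) ^ 2 * 2 ^ 2 < (4 + k + 1) * (4 + 2 * k) ^ 2 := by
    nlinarith
  have hlog := Real.log_lt_log (by positivity) key
  rw [Real.log_mul (by positivity) (by positivity), Real.log_mul (by positivity) (by positivity),
    Real.log_mul (by positivity) (by positivity), Real.log_pow, Real.log_pow, Real.log_pow]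
    at hlog
  push_cast at hlog
  linarith

theorem removalGap_neg {d k : ℝ} (hd : 4 ≤ d) (hk : 0 < k) : removalGap d k < 0 := by
  have h1 := removalGap_antitoneOn_left hk.le (by norm_num : (4 : ℝ) ∈ Set.Ici 1)
    (by simpa using (by linarith : 1 ≤ d)) hd
  have h2 := removalGap_four_strictAntiOn (by simp : (0 : ℝ) ∈ Set.Ici 0) (by simpa using hk.le) hk
  have h3 : removalGap 4 0 = 0 := by
    unfold removalGap
    norm_num
    ring
  simp only at h1 h2
  linarith

theorem log_four : Real.log 4 = 2 * Real.log 2 := by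
  rw [show (4 : ℝ) = 2 ^ 2 by norm_num, Real.log_pow]
  norm_num

theorem log_eight : Real.log 8 = 3 * Real.log 2 := by
  rw [show (8 : ℝ) = 2 ^ 3 by norm_num, Real.log_pow]
  norm_num

theorem log_sixteen : Real.log 16 = 4 * Real.log 2 := by
  rw [show (16 : ℝ) = 2 ^ 4 by norm_num, Real.log_pow]
  norm_num

theorem log_six : Real.log 6 = Real.log 2 + Real.log 3 := by
  rw [show (6 : ℝ) = 2 * 3 by norm_num, Real.log_mul (by norm_num) (by norm_num)]

/-- Needed when the remainder is K_3, whose value 9 log 3 exceeds that of the three-edge star.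
Monotonicity in d leaves only d = 4. -/
theorem removalGap_three {d : ℝ} (hd : 4 ≤ d) :
    removalGap d 3 + (9 * Real.log 3 - starValue 3) < 0 := by
  have h1 := removalGap_antitoneOn_left (show (0 : ℝ) ≤ 3 by norm_num)
    (by norm_num : (4 : ℝ) ∈ Set.Ici 1) (by simpa using (by linarith : 1 ≤ d)) hd
  simp only at h1
  have h2 : Real.log (5 ^ 5 * 7 ^ 14 * 3 ^ 9) < Real.log (2 ^ 32 * 10 ^ 10) :=
    Real.log_lt_log (by positivity) (by norm_num)
  rw [Real.log_mul (by positivity) (by positivity), Real.log_mul (by positivity) (by positivity),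
    Real.log_mul (by positivity) (by positivity)] at h2
  simp only [Real.log_pow] at h2
  have h3 : removalGap 4 3 + (9 * Real.log 3 - starValue 3) < 0 := by
    unfold removalGap starValue
    norm_num [log_four, log_eight] at h2 ⊢
    linarith
  linarith

/-- The same for the remainder K_4, with value 32 log 2. -/
theorem removalGap_six {d : ℝ} (hd : 4 ≤ d) :
    removalGap d 6 + (32 * Real.log 2 - starValue 6) < 0 := by
  have h1 := removalGap_antitoneOn_left (show (0 : ℝ) ≤ 6 by norm_num)
    (by norm_num : (4 : ℝ) ∈ Set.Ici 1) (by simpa using (by linarith : 1 ≤ d)) hd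
  simp only at h1
  have h2 : Real.log (5 ^ 5 * 10 ^ 20) < Real.log (2 ^ 40 * 11 ^ 11) :=
    Real.log_lt_log (by positivity) (by norm_num)
  rw [Real.log_mul (by positivity) (by positivity), Real.log_mul (by positivity) (by positivity)]
    at h2
  simp only [Real.log_pow] at h2
  have h3 : removalGap 4 6 + (32 * Real.log 2 - starValue 6) < 0 := by
    unfold removalGap starValue
    norm_num [log_four, log_sixteen] at h2 ⊢
    linarith
  linarith

/-- The vertex-removal bound in terms of the values at stars. -/
theorem h_one_le_starValue_add {V : Type u} [Fintype V] (G : SimpleGraph V) (v : V) {d k : ℕ}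
    (hd : deg G v = d) (hd0 : 0 < d) (hk : size G = d + k) :
    h 1 G ≤ starValue (d + k) + removalGap d k + (h 1 (removeVertex G v) - starValue k) := by
  have h1 := h_one_le_removeVertex G v hd hd0 hk
  have hd1 : (0 : ℝ) < d := by exact_mod_cast hd0
  have hk0 : (0 : ℝ) ≤ k := Nat.cast_nonneg k
  rw [Real.log_mul (x := 2) (by positivity) (by positivity)] at h1
  unfold starValue removalGap
  push_cast
  linarith

end DegreeEntropy

/-! ### Classification for c = 1 -/

namespace DegreeEntropy

variable {V : Type u} [Fintype V]

theorem f_one_zero : f 1 ((0 : ℕ) : ℝ) = 0 := by simp [f]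

theorem f_one_one : f 1 ((1 : ℕ) : ℝ) = 2 * Real.log 2 := by norm_num [f]

theorem f_one_two : f 1 ((2 : ℕ) : ℝ) = 3 * Real.log 3 := by norm_num [f]

theorem f_one_three : f 1 ((3 : ℕ) : ℝ) = 8 * Real.log 2 := by
  norm_num [f, log_four]
  ring

theorem EqUpToIsolated.h_one_star {G : SimpleGraph V} {m : ℕ} (e : EqUpToIsolated G (star m)) :
    h 1 G = starValue m := by
  rw [h_eq_degSum, e.degSum_eq f_one_zero, degSum_star, f_one_one, f_one, starValue]
  ring

theorem EqUpToIsolated.h_one_K_three {G : SimpleGraph V} (e : EqUpToIsolated G (K 3)) :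
    h 1 G = 9 * Real.log 3 := by
  rw [h_eq_degSum, e.degSum_eq f_one_zero, degSum_K, f_one_two]
  push_cast
  ring

theorem EqUpToIsolated.h_one_K_four {G : SimpleGraph V} (e : EqUpToIsolated G (K 4)) :
    h 1 G = 32 * Real.log 2 := by
  rw [h_eq_degSum, e.degSum_eq f_one_zero, degSum_K, f_one_three]
  push_cast
  ring

/-- In this form the value is visibly 2 f_1(3) + 2 f_1(2), the tie with K_4^-. -/
theorem starValue_five : starValue 5 = 16 * Real.log 2 + 6 * Real.log 3 := by
  norm_num [starValue, log_six]
  ring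

theorem EqUpToIsolated.h_one_K4minus {G : SimpleGraph V} (e : EqUpToIsolated G K4minus) :
    h 1 G = starValue 5 := by
  rw [h_eq_degSum, e.degSum_eq f_one_zero, degSum_K4minus, f_one_three, f_one_two, starValue_five]
  ring

theorem starValue_three_lt : starValue 3 < 9 * Real.log 3 := by
  have h1 : Real.log (2 ^ 14) < Real.log (3 ^ 9) := Real.log_lt_log (by positivity) (by norm_num)
  simp only [Real.log_pow] at h1
  norm_num [starValue, log_four] at h1 ⊢
  linarith

theorem starValue_six_lt : starValue 6 < 32 * Real.log 2 := by
  have h1 : Real.log (7 ^ 7) < Real.log (2 ^ 20) := Real.log_lt_log (by positivity) (by norm_num)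
  simp only [Real.log_pow] at h1
  norm_num [starValue] at h1 ⊢
  linarith

theorem h_le_of_linear_bound (G : SimpleGraph V) {c α : ℝ}
    (hF : ∀ v, f c (deg G v) ≤ deg G v * α) : h c G ≤ 2 * size G * α := by
  rw [h_eq_degSum, ← degSum_natCast, degSum, degSum, Finset.sum_mul]
  exact Finset.sum_le_sum fun v _ => hF v

theorem h_add_le_of_linear_bound (G : SimpleGraph V) {c α ε : ℝ}
    (hF : ∀ v, f c (deg G v) ≤ deg G v * α) (hv : ∃ v, f c (deg G v) + ε ≤ deg G v * α) :
    h c G + ε ≤ 2 * size G * α := by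
  classical
  obtain ⟨v, hv⟩ := hv
  rw [h_eq_degSum, ← degSum_natCast, degSum, degSum, Finset.sum_mul,
    ← Finset.add_sum_erase _ _ (Finset.mem_univ v),
    ← Finset.add_sum_erase _ (fun i => (deg G i : ℝ) * α) (Finset.mem_univ v)]
  have := Finset.sum_le_sum fun w (_ : w ∈ Finset.univ.erase v) => hF w
  linarith

theorem log_two_lt_log_three_pow : 14 * Real.log 2 < 9 * Real.log 3 := by
  have h1 : Real.log (2 ^ 14) < Real.log (3 ^ 9) := Real.log_lt_log (by positivity) (by norm_num)
  simp only [Real.log_pow] at h1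
  push_cast at h1
  exact h1

theorem log_three_lt_log_two_pow : 5 * Real.log 3 < 8 * Real.log 2 := by
  have h1 : Real.log (3 ^ 5) < Real.log (2 ^ 8) := Real.log_lt_log (by positivity) (by norm_num)
  simp only [Real.log_pow] at h1
  push_cast at h1
  exact h1

/-- The ratio f_1(d)/d increases on d = 1, 2, 3, so its value at 3 dominates, with equality only for
d = 0 and d = 3. -/
theorem f_one_le_of_le_three {d : ℕ} (hd : d ≤ 3) : f 1 d ≤ d * (8 / 3 * Real.log 2) := by
  have h2 : 0 < Real.log 2 := Real.log_pos (by norm_num)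
  have h3 := log_three_lt_log_two_pow
  interval_cases d
  · rw [f_one_zero]; simp
  · rw [f_one_one]; push_cast; linarith
  · rw [f_one_two]; push_cast; linarith
  · rw [f_one_three]; push_cast; linarith

theorem f_one_le_of_le_two {d : ℕ} (hd : d ≤ 2) : f 1 d ≤ d * (3 / 2 * Real.log 3) := by
  have h2 : 0 < Real.log 2 := Real.log_pos (by norm_num)
  have h3 := log_two_lt_log_three_pow
  interval_cases d
  · rw [f_one_zero]; simp
  · rw [f_one_one]; push_cast; linarith
  · rw [f_one_two]; push_cast; linarith

theorem sixteen_thirds_lt_starValue {m : ℕ} (hm : 7 ≤ m) :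
    2 * m * (8 / 3 * Real.log 2) < starValue m := by
  have h2 : 0 < Real.log 2 := Real.log_pos (by norm_num)
  unfold starValue
  obtain rfl | rfl | rfl | hm : m = 7 ∨ m = 8 ∨ m = 9 ∨ 10 ≤ m := by omega
  · norm_num [log_eight]
    linarith
  · have h1 : Real.log (2 ^ 80) < Real.log (9 ^ 27) :=
      Real.log_lt_log (by positivity) (by norm_num)
    simp only [Real.log_pow] at h1
    norm_num at h1 ⊢
    linarith
  · have h1 : Real.log (2 ^ 30) < Real.log (10 ^ 10) :=
      Real.log_lt_log (by positivity) (by norm_num)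
    simp only [Real.log_pow] at h1
    norm_num at h1 ⊢
    linarith
  -- For m ≥ 10 the crude bound log(m+1) ≥ (10/3) log 2 suffices, because 10/3 + 2 = 16/3.
  · have h1 : Real.log (2 ^ 10) < Real.log (11 ^ 3) :=
      Real.log_lt_log (by positivity) (by norm_num)
    simp only [Real.log_pow] at h1
    push_cast at h1
    have hm' : (10 : ℝ) ≤ m := by exact_mod_cast hm
    have h3 : Real.log 11 ≤ Real.log (m + 1) := Real.log_le_log (by norm_num) (by linarith)
    have h4 : 10 / 3 * Real.log 2 ≤ Real.log (m + 1) := by linarith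
    have h5 := mul_le_mul_of_nonneg_left h4 (show (0 : ℝ) ≤ m + 1 by linarith)
    nlinarith

theorem card_support_mul {G : SimpleGraph V} {s : ℕ} (hG : ∀ v, deg G v = 0 ∨ deg G v = s) :
    ∃ S : Finset V, G.support ⊆ S ∧ S.card * s = 2 * size G := by
  classical
  refine ⟨Finset.univ.filter fun v => v ∈ G.support, by intro v hv; simpa using hv, ?_⟩
  rw [← sum_deg, ← Finset.sum_subset
    (Finset.subset_univ (Finset.univ.filter fun v => v ∈ G.support)), Finset.sum_const_nat]
  · intro v hv
    rcases hG v with h | h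
    · exact absurd (by simpa using hv) (deg_eq_zero_iff.1 h)
    · exact h
  · intro v _ hv
    exact deg_eq_zero_iff.2 (by simpa using hv)

theorem h_one_lt_of_size_two {G : SimpleGraph V} (hG : size G = 2) (hdeg : ∀ v, deg G v ≤ 1) :
    h 1 G < starValue 2 := by
  have h1 : h 1 G ≤ 2 * size G * (2 * Real.log 2) := by
    refine h_le_of_linear_bound G fun v => ?_
    have := hdeg v
    interval_cases deg G v
    · rw [f_one_zero]; simp
    · rw [f_one_one]; simp
  rw [hG] at h1
  have h2 := log_two_lt_log_three_pow
  have h3 : 0 < Real.log 2 := Real.log_pos (by norm_num)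
  norm_num [starValue] at h1 ⊢
  linarith

theorem h_one_lt_of_size_three {G : SimpleGraph V} (hG : size G = 3) (hdeg : ∀ v, deg G v ≤ 2) :
    h 1 G < starValue 3 ∨ EqUpToIsolated G (K 3) := by
  by_cases hall : ∀ v, deg G v = 0 ∨ deg G v = 2
  · right
    obtain ⟨S, hS, hcard⟩ := card_support_mul hall
    exact eqUpToIsolated_K G S (by omega) hS hG
  · left
    push Not at hall
    obtain ⟨v, hv0, hv2⟩ := hall
    have hv : deg G v = 1 := by
      have := hdeg v
      omega
    -- A vertex of degree 1 loses exactly this much against the linear bound.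
    have h1 : h 1 G + (3 / 2 * Real.log 3 - 2 * Real.log 2) ≤ 2 * size G * (3 / 2 * Real.log 3) := by
      refine h_add_le_of_linear_bound G (fun v => f_one_le_of_le_two (hdeg v)) ⟨v, ?_⟩
      rw [hv, f_one_one]
      simp
    rw [hG] at h1
    have h2 := log_three_lt_log_two_pow
    norm_num [starValue, log_four] at h1 ⊢
    linarith

theorem h_one_lt_of_size_four_or_five {G : SimpleGraph V} (hG : size G = 4 ∨ size G = 5)
    (hdeg : ∀ v, deg G v ≤ 2) : h 1 G < starValue (size G) := by
  have h1 : h 1 G ≤ 2 * size G * (3 / 2 * Real.log 3) :=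
    h_le_of_linear_bound G fun v => f_one_le_of_le_two (hdeg v)
  rcases hG with hG | hG
  · have h2 : Real.log (3 ^ 12) < Real.log (5 ^ 5 * 2 ^ 8) :=
      Real.log_lt_log (by positivity) (by norm_num)
    rw [Real.log_mul (by positivity) (by positivity)] at h2
    simp only [Real.log_pow] at h2
    rw [hG] at h1 ⊢
    norm_num [starValue] at h1 h2 ⊢
    linarith
  · have h2 := log_three_lt_log_two_pow
    have h3 : 0 < Real.log 3 := Real.log_pos (by norm_num)
    rw [hG] at h1 ⊢
    rw [starValue_five]
    push_cast at h1
    linarith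

theorem h_one_lt_of_size_six {G : SimpleGraph V} (hG : size G = 6) (hdeg : ∀ v, deg G v ≤ 3) :
    h 1 G < starValue 6 ∨ EqUpToIsolated G (K 4) := by
  by_cases hall : ∀ v, deg G v = 0 ∨ deg G v = 3
  · right
    obtain ⟨S, hS, hcard⟩ := card_support_mul hall
    exact eqUpToIsolated_K G S (by omega) hS hG
  · left
    push Not at hall
    obtain ⟨v, hv0, hv3⟩ := hall
    have hv : deg G v = 1 ∨ deg G v = 2 := by
      have := hdeg v
      omega
    -- The loss at degree 2, which is smaller than the loss at degree 1 and so covers both.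
    have h1 : h 1 G + (16 / 3 * Real.log 2 - 3 * Real.log 3) ≤
        2 * size G * (8 / 3 * Real.log 2) := by
      refine h_add_le_of_linear_bound G (fun v => f_one_le_of_le_three (hdeg v)) ⟨v, ?_⟩
      have h2 := log_two_lt_log_three_pow
      rcases hv with hv | hv
      · rw [hv, f_one_one]
        push_cast
        linarith
      · rw [hv, f_one_two]
        push_cast
        linarith
    rw [hG] at h1
    have h2 : Real.log (2 ^ 44 * 3 ^ 9) < Real.log (7 ^ 21) :=
      Real.log_lt_log (by positivity) (by norm_num)
    rw [Real.log_mul (by positivity) (by positivity)] at h2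
    simp only [Real.log_pow] at h2
    norm_num [starValue] at h1 h2 ⊢
    linarith

open Classical in
/-- The exact vertex-removal identity, bounded by a linear estimate of the increments around a
vertex of degree three. -/
theorem h_one_le_of_deg_three (G : SimpleGraph V) (v : V) (hv : deg G v = 3) (α β : ℝ)
    (hαβ : ∀ d : ℕ, 1 ≤ d → d ≤ 3 → f 1 d - f 1 (d - 1 : ℕ) ≤ α + d * β)
    (hdeg : ∀ v, deg G v ≤ 3) :
    h 1 G ≤ 8 * Real.log 2 + 3 * α + (∑ w ∈ G.neighborFinset v, deg G w : ℕ) * β +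
      h 1 (removeVertex G v) := by
  have h1 := degSum_removeVertex G v fun d => f 1 d
  rw [← h_eq_degSum, ← h_eq_degSum, hv, f_one_zero, f_one_three] at h1
  have h2 : ∑ w ∈ G.neighborFinset v, (f 1 (deg G w) - f 1 (deg G w - 1 : ℕ)) ≤
      ∑ w ∈ G.neighborFinset v, (α + deg G w * β) :=
    Finset.sum_le_sum fun w hw =>
      hαβ _ (deg_pos_of_adj ((G.mem_neighborFinset v w).1 hw).symm) (hdeg w)
  rw [Finset.sum_add_distrib, Finset.sum_const, card_neighborFinset_eq_deg, hv,
    ← Finset.sum_mul, ← Nat.cast_sum, nsmul_eq_mul] at h2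
  push_cast at h2 ⊢
  linarith

theorem h_one_lt_of_size_four {G : SimpleGraph V} (hG : size G = 4) (hdeg : ∀ v, deg G v ≤ 3)
    {v : V} (hv : deg G v = 3) (hrem : h 1 (removeVertex G v) ≤ starValue 1) :
    h 1 G < starValue 4 := by
  classical
  have h23 := log_two_lt_log_three_pow
  have h2 : 0 < Real.log 2 := Real.log_pos (by norm_num)
  -- The chord of the concave increment sequence through degrees 1 and 2.
  have h1 := h_one_le_of_deg_three G v hv (6 * Real.log 2 - 3 * Real.log 3)
    (3 * Real.log 3 - 4 * Real.log 2) (by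
      intro d hd1 hd3
      interval_cases d
      · rw [f_one_one, f_one_zero]; push_cast; linarith
      · rw [f_one_two, f_one_one]; push_cast; linarith
      · rw [f_one_three, f_one_two]; push_cast; linarith) hdeg
  have hS := deg_add_sum_neighbor_add_sum G v
  set S := ∑ w ∈ G.neighborFinset v, deg G w
  have hS5 : (S : ℝ) ≤ 5 := by
    have : S ≤ 5 := by omega
    exact_mod_cast this
  have h3 := mul_le_mul_of_nonneg_right hS5
    (show 0 ≤ 3 * Real.log 3 - 4 * Real.log 2 by linarith)
  have h4 : Real.log (2 ^ 2 * 3 ^ 6) < Real.log (5 ^ 5) :=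
    Real.log_lt_log (by positivity) (by norm_num)
  rw [Real.log_mul (by positivity) (by positivity)] at h4
  simp only [Real.log_pow] at h4
  norm_num [starValue] at hrem h4 ⊢
  linarith

theorem h_one_lt_of_size_five {G : SimpleGraph V} (hG : size G = 5) (hdeg : ∀ v, deg G v ≤ 3)
    {v : V} (hv : deg G v = 3) (hrem : h 1 (removeVertex G v) ≤ starValue 2) :
    h 1 G < starValue 5 ∨ EqUpToIsolated G K4minus := by
  classical
  have h23 := log_two_lt_log_three_pow
  have h32 := log_three_lt_log_two_pow
  have h2 : 0 < Real.log 2 := Real.log_pos (by norm_num)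
  have h3 : 0 < Real.log 3 := Real.log_pos (by norm_num)
  -- The chord through degrees 2 and 3, exact on K_4^-, where the neighbours of v have degrees 2, 2,
  -- 3.
  have h1 := h_one_le_of_deg_three G v hv (15 * Real.log 3 - 22 * Real.log 2)
    (10 * Real.log 2 - 6 * Real.log 3) (by
      intro d hd1 hd3
      interval_cases d
      · rw [f_one_one, f_one_zero]; push_cast; linarith
      · rw [f_one_two, f_one_one]; push_cast; linarith
      · rw [f_one_three, f_one_two]; push_cast; linarith) hdeg
  have hS := deg_add_sum_neighbor_add_sum G v
  -- Since 3 + 7 = 2 · 5, a neighbour sum of 7 confines all edges to the four vertices of the closed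
  -- neighbourhood.
  by_cases hS7 : 7 ≤ ∑ w ∈ G.neighborFinset v, deg G w
  · right
    obtain ⟨T, hT, hsub⟩ := support_subset_of_sum_neighbor G v (G.neighborFinset v) (by simp)
      (by omega)
    exact eqUpToIsolated_K4minus G T (by omega) hsub hG
  · left
    set S := ∑ w ∈ G.neighborFinset v, deg G w
    have hS6 : (S : ℝ) ≤ 6 := by
      have : S ≤ 6 := by omega
      exact_mod_cast this
    have h4 := mul_le_mul_of_nonneg_right hS6
      (show 0 ≤ 10 * Real.log 2 - 6 * Real.log 3 by linarith)
    rw [starValue_five]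
    norm_num [starValue] at hrem
    linarith

theorem eqUpToIsolated_of_size_eq_zero {W : Type*} [Fintype W] {G : SimpleGraph V}
    {H : SimpleGraph W} (hG : size G = 0) (hH : size H = 0) : EqUpToIsolated G H := by
  have h1 : IsEmpty G.support := ⟨fun v =>
    (deg_eq_zero_iff (G := G)).1 (by have := deg_le_size G v; omega) v.2⟩
  have h2 : IsEmpty H.support := ⟨fun v =>
    (deg_eq_zero_iff (G := H)).1 (by have := deg_le_size H v; omega) v.2⟩
  exact ⟨⟨Equiv.equivOfIsEmpty _ _, fun {a} => h1.elim a⟩⟩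

/-- Every graph either has `h_1` below the star with as many edges, or is that star, or is one of
`K_3`, `K_4^-`, `K_4`. -/
theorem h_one_classification (m : ℕ) (G : SimpleGraph V) (hG : size G = m) :
    EqUpToIsolated G (star m) ∨ h 1 G < starValue m ∨ (m = 3 ∧ EqUpToIsolated G (K 3)) ∨
      (m = 5 ∧ EqUpToIsolated G K4minus) ∨ (m = 6 ∧ EqUpToIsolated G (K 4)) := by
  induction m using Nat.strong_induction_on generalizing G with
  | _ m ih =>
  have hstar : ∀ v, deg G v = m → EqUpToIsolated G (star m) := by
    intro v hv
    have := eqUpToIsolated_star G v (hv.trans hG.symm)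
    rwa [hG] at this
  have hle : ∀ v, deg G v ≤ m := fun v => hG ▸ deg_le_size G v
  by_cases hs : ∃ v, deg G v = m
  · obtain ⟨v, hv⟩ := hs
    exact Or.inl (hstar v hv)
  push Not at hs
  have hlt : ∀ v, deg G v < m := fun v => lt_of_le_of_ne (hle v) (hs v)
  by_cases h4 : ∃ v, 4 ≤ deg G v
  · obtain ⟨v, hv⟩ := h4
    obtain ⟨k, hk⟩ : ∃ k, m = deg G v + k := ⟨m - deg G v, by have := hle v; omega⟩
    have hkpos : 0 < k := by have := hlt v; omega
    have hsize : size (removeVertex G v) = k := by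
      have := size_removeVertex G v
      omega
    have hb := h_one_le_starValue_add G v rfl (by omega) (hG.trans hk)
    have hd4 : (4 : ℝ) ≤ deg G v := by exact_mod_cast hv
    have hk0 : (0 : ℝ) < k := by exact_mod_cast hkpos
    have hneg := removalGap_neg hd4 hk0
    rw [← hk] at hb
    right; left
    rcases ih k (by omega) (removeVertex G v) hsize with e | e | ⟨rfl, e⟩ | ⟨rfl, e⟩ | ⟨rfl, e⟩
    · rw [e.h_one_star] at hb
      linarith
    · linarith
    · rw [e.h_one_K_three] at hb
      have := removalGap_three hd4
      push_cast at hb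
      linarith
    · rw [e.h_one_K4minus] at hb
      linarith
    · rw [e.h_one_K_four] at hb
      have := removalGap_six hd4
      push_cast at hb
      linarith
  push Not at h4
  have h3 : ∀ v, deg G v ≤ 3 := fun v => Nat.le_of_lt_succ (h4 v)
  have hrem : ∀ k, k < m → k ≤ 2 → ∀ H : SimpleGraph V, size H = k → h 1 H ≤ starValue k := by
    intro k hkm hk2 H hH
    rcases ih k hkm H hH with e | e | ⟨rfl, e⟩ | ⟨rfl, e⟩ | ⟨rfl, e⟩
    · exact e.h_one_star.le
    · exact e.le
    all_goals omega
  have hsum := sum_deg G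
  by_cases hm7 : 7 ≤ m
  · right; left
    have h1 : h 1 G ≤ 2 * size G * (8 / 3 * Real.log 2) :=
      h_le_of_linear_bound G fun v => f_one_le_of_le_three (h3 v)
    rw [hG] at h1
    exact h1.trans_lt (sixteen_thirds_lt_starValue hm7)
  push Not at hm7
  have hdrop : m = 4 ∨ m = 5 → ¬ (∃ v, deg G v = 3) → h 1 G < starValue m := by
    intro hm hno
    push Not at hno
    rw [← hG] at hm ⊢
    exact h_one_lt_of_size_four_or_five hm fun v =>
      Nat.le_of_lt_succ (lt_of_le_of_ne (h3 v) (hno v))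
  interval_cases m
  · left
    exact eqUpToIsolated_of_size_eq_zero hG (size_star 0)
  · exfalso
    have : ∑ v, deg G v = 0 := Finset.sum_eq_zero fun v _ => by have := hlt v; omega
    omega
  · exact Or.inr (Or.inl (h_one_lt_of_size_two hG fun v => Nat.le_of_lt_succ (hlt v)))
  · rcases h_one_lt_of_size_three hG fun v => Nat.le_of_lt_succ (hlt v) with h | h
    · exact Or.inr (Or.inl h)
    · exact Or.inr (Or.inr (Or.inl ⟨rfl, h⟩))
  · right; left
    by_cases h5 : ∃ v, deg G v = 3
    · obtain ⟨v, hv⟩ := h5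
      have := size_removeVertex G v
      exact h_one_lt_of_size_four hG h3 hv (hrem 1 (by omega) (by omega) _ (by omega))
    · exact hdrop (by omega) h5
  · by_cases h5 : ∃ v, deg G v = 3
    · obtain ⟨v, hv⟩ := h5
      have := size_removeVertex G v
      rcases h_one_lt_of_size_five hG h3 hv (hrem 2 (by omega) (by omega) _ (by omega)) with h | h
      · exact Or.inr (Or.inl h)
      · exact Or.inr (Or.inr (Or.inr (Or.inl ⟨rfl, h⟩)))
    · exact Or.inr (Or.inl (hdrop (by omega) h5))
  · rcases h_one_lt_of_size_six hG h3 with h | h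
    · exact Or.inr (Or.inl h)
    · exact Or.inr (Or.inr (Or.inr (Or.inr ⟨rfl, h⟩)))

end DegreeEntropy

/-! ### Second differences and the passage from c to c + 1 -/

namespace DegreeEntropy

/-- The second difference of `x log x`. -/
noncomputable def secondDiff (x : ℝ) : ℝ :=
  (x + 2) * Real.log (x + 2) - 2 * ((x + 1) * Real.log (x + 1)) + x * Real.log x

theorem quadratic_inv_pos (s : ℝ) {t : ℝ} (ht : 0 < t) :
    0 < s ^ 2 * t⁻¹ + 2 * s * (t + 1)⁻¹ + (t + 2)⁻¹ := by
  have h : s ^ 2 * t⁻¹ + 2 * s * (t + 1)⁻¹ + (t + 2)⁻¹ =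
      ((s * (t + 1) + t) ^ 2 * (t + 2) + t) / (t * (t + 1) ^ 2 * (t + 2)) := by
    field_simp
    ring
  rw [h]
  positivity

/-- The form is the second difference at x of s²φ(t) + 2sφ(t+1) + φ(t+2), with φ(t) = t log t. The
second derivative of this function is positive by `quadratic_inv_pos`, which expresses the
log-convexity of 1/t. -/
theorem secondDiff_quadratic_pos (s : ℝ) {x : ℝ} (hx : 0 < x) :
    0 < s ^ 2 * secondDiff x + 2 * s * secondDiff (x + 1) + secondDiff (x + 2) := by
  let q : ℝ → ℝ := fun t => s ^ 2 * (t * Real.log t) + 2 * s * ((t + 1) * Real.log (t + 1)) +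
    (t + 2) * Real.log (t + 2)
  let q' : ℝ → ℝ := fun t => s ^ 2 * (Real.log t + 1) + 2 * s * (Real.log (t + 1) + 1) +
    (Real.log (t + 2) + 1)
  have hq : ∀ t, 0 < t → HasDerivAt q (q' t) t := by
    intro t ht
    have i := hasDerivAt_id' t
    have h1 := hasDerivAt_mul_log_comp i ht
    have h2 := hasDerivAt_mul_log_comp (i.add_const 1) (by linarith)
    have h3 := hasDerivAt_mul_log_comp (i.add_const 2) (by linarith)
    exact (((h1.const_mul (s ^ 2)).add (h2.const_mul (2 * s))).add h3).congr_deriv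
      (by simp only [q', mul_one])
  have hq' : ∀ t, 0 < t →
      HasDerivAt q' (s ^ 2 * t⁻¹ + 2 * s * (t + 1)⁻¹ + (t + 2)⁻¹) t := by
    intro t ht
    have i := hasDerivAt_id' t
    have h1 := (i.log ht.ne').add_const 1
    have h2 := ((i.add_const 1).log (by linarith)).add_const 1
    have h3 := ((i.add_const 2).log (by linarith)).add_const 1
    exact (((h1.const_mul (s ^ 2)).add (h2.const_mul (2 * s))).add h3).congr_deriv
      (by simp only [one_div])
  have hmono : StrictMonoOn q' (Set.Ioi 0) := by
    refine strictMonoOn_of_deriv_pos (convex_Ioi 0)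
      (fun t ht => (hq' t ht).continuousAt.continuousWithinAt) fun t ht => ?_
    have ht0 : 0 < t := interior_subset ht
    rw [(hq' t ht0).deriv]
    exact quadratic_inv_pos s ht0
  have hconv : StrictConvexOn ℝ (Set.Ioi 0) q := by
    refine StrictMonoOn.strictConvexOn_of_deriv (convex_Ioi 0)
      (fun t ht => (hq t ht).continuousAt.continuousWithinAt) ?_
    rw [interior_Ioi]
    intro a ha b hb hab
    rw [(hq a ha).deriv, (hq b hb).deriv]
    exact hmono ha hb hab
  have h := hconv.2 (show x ∈ Set.Ioi 0 from hx) (show x + 2 ∈ Set.Ioi 0 from by simp; linarith)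
    (by linarith) (show (0 : ℝ) < 1 / 2 by norm_num) (show (0 : ℝ) < 1 / 2 by norm_num)
    (by norm_num)
  have hmid : (1 / 2 : ℝ) • x + (1 / 2 : ℝ) • (x + 2) = x + 1 := by
    simp only [smul_eq_mul]
    ring
  rw [hmid] at h
  simp only [smul_eq_mul, q] at h
  unfold secondDiff
  ring_nf at h ⊢
  linarith

theorem secondDiff_pos {x : ℝ} (hx : 0 < x) : 0 < secondDiff x := by
  have h := Real.strictConvexOn_mul_log.2 (show x ∈ Set.Ici 0 from hx.le)
    (show x + 2 ∈ Set.Ici 0 from by simp; linarith) (by linarith)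
    (show (0 : ℝ) < 1 / 2 by norm_num) (show (0 : ℝ) < 1 / 2 by norm_num) (by norm_num)
  have hmid : (1 / 2 : ℝ) • x + (1 / 2 : ℝ) • (x + 2) = x + 1 := by
    simp only [smul_eq_mul]
    ring
  rw [hmid] at h
  simp only [smul_eq_mul] at h
  unfold secondDiff
  linarith

/-- The second difference of `x log x` is strictly log-convex. -/
theorem secondDiff_ratio_lt {x : ℝ} (hx : 0 < x) :
    secondDiff (x + 1) / secondDiff x < secondDiff (x + 2) / secondDiff (x + 1) := by
  have h0 := secondDiff_pos hx
  have h1 := secondDiff_pos (show 0 < x + 1 by linarith)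
  -- This s minimizes the quadratic, so positivity there is the discriminant inequality.
  have h := secondDiff_quadratic_pos (-(secondDiff (x + 1) / secondDiff x)) hx
  have h2 : (-(secondDiff (x + 1) / secondDiff x)) ^ 2 * secondDiff x +
      2 * -(secondDiff (x + 1) / secondDiff x) * secondDiff (x + 1) =
      -(secondDiff (x + 1) / secondDiff x * secondDiff (x + 1)) := by
    field_simp
    ring
  rw [h2] at h
  rw [lt_div_iff₀ h1]
  linarith

theorem secondDiff_ratio_strictMono {c : ℝ} (hc : 0 < c) :
    StrictMono fun j : ℕ => secondDiff (c + j + 1) / secondDiff (c + j) := by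
  refine strictMono_nat_of_lt_succ fun j => ?_
  have h := secondDiff_ratio_lt (show 0 < c + j by positivity)
  push_cast
  rwa [show c + (j + 1) + 1 = c + j + 2 by ring, ← add_assoc c (j : ℝ) 1]

/-- The expansion of a sequence in terms of its second differences. -/
theorem eq_sum_second_differences (F : ℕ → ℝ) {d m : ℕ} (hd : d ≤ m + 1) :
    F d = F 0 + d * (F 1 - F 0) +
      ∑ j ∈ Finset.range m, ((d - 1 - j : ℕ) : ℝ) * (F (j + 2) - 2 * F (j + 1) + F j) := by
  induction d with
  | zero => simp
  | succ d ih =>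
    have ih := ih (by omega)
    -- Truncated subtraction makes the weights positive parts: passing from d to d + 1 adds one
    -- second difference for each j < d, and these telescope.
    have h1 : ∑ j ∈ Finset.range m, ((d + 1 - 1 - j : ℕ) : ℝ) * (F (j + 2) - 2 * F (j + 1) + F j) =
        ∑ j ∈ Finset.range m, ((d - 1 - j : ℕ) : ℝ) * (F (j + 2) - 2 * F (j + 1) + F j) +
        ∑ j ∈ Finset.range m, if j ∈ Finset.range d then F (j + 2) - 2 * F (j + 1) + F j else 0 := by
      rw [← Finset.sum_add_distrib]
      refine Finset.sum_congr rfl fun j _ => ?_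
      split_ifs with hj
      · rw [Finset.mem_range] at hj
        rw [show d + 1 - 1 - j = (d - 1 - j) + 1 by omega]
        push_cast
        ring
      · rw [Finset.mem_range] at hj
        rw [show d + 1 - 1 - j = 0 by omega, show d - 1 - j = 0 by omega]
        simp
    have h2 : ∀ n : ℕ, ∑ j ∈ Finset.range n, (F (j + 2) - 2 * F (j + 1) + F j) =
        F (n + 1) - F n - (F 1 - F 0) := by
      intro n
      induction n with
      | zero => simp
      | succ n ihn =>
        rw [Finset.sum_range_succ, ihn]
        ring
    rw [h1, Finset.sum_ite_mem, Finset.inter_eq_right.2 (Finset.range_subset_range.2 (by omega)),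
      h2 d]
    push_cast
    linarith

variable {V : Type u} [Fintype V]

/-- The amount by which the star with as many edges as `G` exceeds `G`, isolated vertices being
discounted. -/
noncomputable def starGap (c : ℝ) (G : SimpleGraph V) : ℝ :=
  (f c (size G) - f c 0) + size G * (f c 1 - f c 0) - degSum (fun d => f c d - f c 0) G

/-- The coefficients of the star gap with respect to second differences. -/
noncomputable def gapCoeff (G : SimpleGraph V) (j : ℕ) : ℝ :=
  ((size G - 1 - j : ℕ) : ℝ) - ((∑ v, (deg G v - 1 - j) : ℕ) : ℝ)

/-- Both degree sums equal 2m, so the linear terms cancel; the leaves of the star have no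
second-difference part. -/
theorem starGap_eq (c : ℝ) (G : SimpleGraph V) :
    starGap c G = ∑ j ∈ Finset.range (size G), gapCoeff G j * secondDiff (c + j) := by
  have hF : ∀ d, d ≤ size G → f c d - f c 0 = d * (f c 1 - f c 0) +
      ∑ j ∈ Finset.range (size G), ((d - 1 - j : ℕ) : ℝ) * secondDiff (c + j) := by
    intro d hd
    have := eq_sum_second_differences (fun d => f c d) (m := size G) (d := d) (by omega)
    simp only [Nat.cast_zero, Nat.cast_one] at this
    rw [this, add_assoc, add_sub_cancel_left]
    congr 1
    refine Finset.sum_congr rfl fun j _ => ?_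
    congr 1
    simp only [f, secondDiff]
    push_cast
    ring_nf
  have h1 : degSum (fun d => f c d - f c 0) G = 2 * size G * (f c 1 - f c 0) +
      ∑ j ∈ Finset.range (size G), ((∑ v, (deg G v - 1 - j) : ℕ) : ℝ) * secondDiff (c + j) := by
    rw [← degSum_natCast, degSum, degSum, Finset.sum_congr rfl fun v _ => hF _ (deg_le_size G v),
      Finset.sum_add_distrib, Finset.sum_mul, Finset.sum_comm]
    congr 1
    refine Finset.sum_congr rfl fun j _ => ?_
    rw [Nat.cast_sum, Finset.sum_mul]
  rw [starGap, h1, hF _ le_rfl]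
  simp only [gapCoeff, sub_mul, Finset.sum_sub_distrib]
  ring

/-- As d ≤ m, the ratio of (d-1-j)⁺ to m-1-j does not increase with j while the denominator is
positive. Hence the coefficients cannot become negative again. -/
theorem gapCoeff_nonneg_of_le (G : SimpleGraph V) {i j : ℕ} (hij : i ≤ j)
    (hi : 0 ≤ gapCoeff G i) : 0 ≤ gapCoeff G j := by
  unfold gapCoeff at *
  rw [sub_nonneg] at *
  have hi' : ∑ v, (deg G v - 1 - i) ≤ size G - 1 - i := by exact_mod_cast hi
  suffices ∑ v, (deg G v - 1 - j) ≤ size G - 1 - j by exact_mod_cast this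
  by_cases hs : size G - 1 - i = 0
  · rw [Finset.sum_eq_zero]
    · exact Nat.zero_le _
    · intro v _
      have := deg_le_size G v
      omega
  refine Nat.le_of_mul_le_mul_right ?_ (Nat.pos_of_ne_zero hs)
  calc (∑ v, (deg G v - 1 - j)) * (size G - 1 - i)
      = ∑ v, (deg G v - 1 - j) * (size G - 1 - i) := Finset.sum_mul ..
    _ ≤ ∑ v, (deg G v - 1 - i) * (size G - 1 - j) := by
        refine Finset.sum_le_sum fun v _ => ?_
        by_cases hv : deg G v - 1 - j = 0
        · simp [hv]
        · have hd := deg_le_size G v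
          obtain ⟨a, ha⟩ : ∃ a, deg G v = a + 1 + j := ⟨deg G v - 1 - j, by omega⟩
          obtain ⟨b, hb⟩ := Nat.exists_eq_add_of_le hd
          obtain ⟨e, he⟩ := Nat.exists_eq_add_of_le hij
          rw [show deg G v - 1 - j = a by omega, show size G - 1 - i = a + b + e by omega,
            show deg G v - 1 - i = a + e by omega, show size G - 1 - j = a + b by omega]
          nlinarith [Nat.zero_le (b * e)]
    _ = (∑ v, (deg G v - 1 - i)) * (size G - 1 - j) := (Finset.sum_mul ..).symm
    _ ≤ (size G - 1 - i) * (size G - 1 - j) := Nat.mul_le_mul_right _ hi'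
    _ = (size G - 1 - j) * (size G - 1 - i) := Nat.mul_comm _ _

/-- If a graph other than a star does not exceed the star for `c`, then it is strictly below the
star for `c + 1`. -/
theorem starGap_add_one_pos {c : ℝ} (hc : 0 < c) (G : SimpleGraph V) (hG : 2 ≤ size G)
    (hdeg : ∀ v, deg G v < size G) (h : 0 ≤ starGap c G) : 0 < starGap (c + 1) G := by
  classical
  obtain ⟨n, hn⟩ := Nat.exists_eq_add_of_le hG
  -- Here n = m - 2, and all degrees are at most m - 1, so only the star's centre contributes.
  have hlast : gapCoeff G n = 1 := by
    unfold gapCoeff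
    rw [Finset.sum_eq_zero]
    · rw [show size G - 1 - n = 1 by omega]
      simp
    · intro v _
      have := hdeg v
      omega
  have hw : ∀ j : ℕ, 0 < secondDiff (c + j) := fun j => secondDiff_pos (by positivity)
  have hw' : ∀ j : ℕ, 0 < secondDiff (c + j + 1) := fun j => secondDiff_pos (by positivity)
  have hex : ∃ j, 0 ≤ gapCoeff G j := ⟨n, by rw [hlast]; norm_num⟩
  have h1 : starGap (c + 1) G =
      ∑ j ∈ Finset.range (size G), gapCoeff G j * secondDiff (c + j + 1) := by
    rw [starGap_eq]
    refine Finset.sum_congr rfl fun j _ => ?_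
    rw [add_right_comm]
  by_cases h0 : 0 ≤ gapCoeff G 0
  · rw [h1]
    refine Finset.sum_pos' (fun j _ => mul_nonneg (gapCoeff_nonneg_of_le G (Nat.zero_le j) h0)
      (hw' j).le) ⟨n, Finset.mem_range.2 (by omega), ?_⟩
    rw [hlast, one_mul]
    exact hw' n
  · let r : ℕ → ℝ := fun j => secondDiff (c + j + 1) / secondDiff (c + j)
    have hr : StrictMono r := secondDiff_ratio_strictMono hc
    have hrw : ∀ j : ℕ, secondDiff (c + j + 1) = r j * secondDiff (c + j) := fun j =>
      (div_mul_cancel₀ _ (hw j).ne').symm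
    let p := Nat.find hex
    have hp : 0 ≤ gapCoeff G p := Nat.find_spec hex
    have hp0 : 0 < p := by
      rcases Nat.eq_zero_or_pos p with hz | hz
      · rw [hz] at hp
        exact absurd hp h0
      · exact hz
    -- At the sign change p, the factors a_j and r_j - r_p never have opposite signs; strictness
    -- comes from j = 0.
    have h2 : 0 < starGap (c + 1) G - r p * starGap c G := by
      rw [h1, starGap_eq, Finset.mul_sum, ← Finset.sum_sub_distrib]
      have h3 : ∀ j : ℕ, gapCoeff G j * secondDiff (c + j + 1) -
          r p * (gapCoeff G j * secondDiff (c + j)) =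
          gapCoeff G j * (r j - r p) * secondDiff (c + j) := by
        intro j
        rw [hrw j]
        ring
      refine Finset.sum_pos' (fun j _ => ?_) ⟨0, Finset.mem_range.2 (by omega), ?_⟩
      · rw [h3]
        refine mul_nonneg ?_ (hw j).le
        rcases lt_or_ge j p with hj | hj
        · exact mul_nonneg_of_nonpos_of_nonpos (not_le.1 (Nat.find_min hex hj)).le
            (sub_nonpos.2 (hr hj).le)
        · exact mul_nonneg (gapCoeff_nonneg_of_le G hj hp) (sub_nonneg.2 (hr.monotone hj))
      · rw [h3]
        exact mul_pos (mul_pos_of_neg_of_neg (not_le.1 h0) (sub_neg.2 (hr hp0))) (hw 0)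
    have h4 : 0 < r p := div_pos (hw' p) (hw p)
    nlinarith [mul_nonneg h4.le h]

theorem starGap_pos_of_le {a c : ℕ} (ha : 0 < a) (hac : a < c) (G : SimpleGraph V)
    (hG : 2 ≤ size G) (hdeg : ∀ v, deg G v < size G) (h : 0 ≤ starGap a G) :
    0 < starGap c G := by
  have ha' : (0 : ℝ) < a := by exact_mod_cast ha
  induction c, hac using Nat.le_induction with
  | base =>
    push_cast
    exact starGap_add_one_pos ha' G hG hdeg h
  | succ c hc ih =>
    push_cast
    exact starGap_add_one_pos (by exact_mod_cast (by omega : 0 < c)) G hG hdeg ih.le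

end DegreeEntropy

/-! ### Maximizers for all c -/

namespace DegreeEntropy

variable {V : Type u} [Fintype V]

/-- The order enters only through a constant, so at fixed order comparing h_c amounts to comparing
star gaps. -/
theorem h_eq_add_card (c : ℝ) (G : SimpleGraph V) :
    h c G = degSum (fun d => f c d - f c 0) G + Fintype.card V * f c 0 := by
  rw [h_eq_degSum, degSum, degSum, Finset.sum_sub_distrib]
  simp

theorem starGap_one (G : SimpleGraph V) : starGap 1 G = starValue (size G) - h 1 G := by
  have h0 : f 1 0 = 0 := by simpa using f_one_zero
  have h1 : f 1 1 = 2 * Real.log 2 := by simpa using f_one_one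
  rw [starGap, h_eq_add_card, h0, h1, f_one, starValue]
  ring

theorem two_le_size_of_not_star {G : SimpleGraph V} (hG : ¬ EqUpToIsolated G (star (size G))) :
    2 ≤ size G ∧ ∀ v, deg G v < size G := by
  have hlt : ∀ v, deg G v < size G := fun v =>
    lt_of_le_of_ne (deg_le_size G v) fun hv => hG (eqUpToIsolated_star G v hv)
  refine ⟨?_, hlt⟩
  by_contra! hcon
  have hzero : ∑ v, deg G v = 0 := Finset.sum_eq_zero fun v _ => by have := hlt v; omega
  rw [sum_deg] at hzero
  have hs : size G = 0 := by omega
  exact hG (by rw [hs]; exact eqUpToIsolated_of_size_eq_zero hs (size_star 0))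

/-- K_4 beats the star at c = 1, so its propagation has to start at c = 2, where the claim is 5^20 <
6^18. -/
theorem starGap_two_K_four_pos {G : SimpleGraph V} (e : EqUpToIsolated G (K 4)) :
    0 < starGap 2 G := by
  have h1 : Real.log (5 ^ 20) < Real.log (2 ^ 18 * 3 ^ 18) :=
    Real.log_lt_log (by positivity) (by norm_num)
  rw [Real.log_mul (by positivity) (by positivity)] at h1
  simp only [Real.log_pow] at h1
  rw [starGap, e.degSum_eq (by simp), e.size_eq, size_K_four, degSum_K]
  norm_num [f, log_eight] at h1 ⊢
  linarith

/-- For `c ≥ 2` a graph is a star, or a triangle, or strictly below the star. -/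
theorem starGap_classification {c : ℕ} (hc : 2 ≤ c) (G : SimpleGraph V) :
    EqUpToIsolated G (star (size G)) ∨ 0 < starGap c G ∨
      (size G = 3 ∧ EqUpToIsolated G (K 3)) := by
  by_cases hs : EqUpToIsolated G (star (size G))
  · exact Or.inl hs
  obtain ⟨h2, hdeg⟩ := two_le_size_of_not_star hs
  have htrans : h 1 G ≤ starValue (size G) → 0 < starGap c G := by
    intro hle
    refine starGap_pos_of_le one_pos (by omega) G h2 hdeg ?_
    rw [Nat.cast_one, starGap_one]
    linarith
  rcases h_one_classification (size G) G rfl with e | e | e | ⟨h5, e⟩ | ⟨-, e⟩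
  · exact absurd e hs
  · exact Or.inr (Or.inl (htrans e.le))
  · exact Or.inr (Or.inr e)
  -- The tie at c = 1 is enough, since propagation turns a weak inequality into a strict one.
  · exact Or.inr (Or.inl (htrans (by rw [e.h_one_K4minus, h5])))
  · right; left
    have hpos := starGap_two_K_four_pos e
    rcases eq_or_lt_of_le hc with rfl | hlt
    · exact_mod_cast hpos
    · exact starGap_pos_of_le two_pos hlt G h2 hdeg (by exact_mod_cast hpos.le)

theorem secondDiff_strictAntiOn : StrictAntiOn secondDiff (Set.Ioi 0) := by
  have hder : ∀ x : ℝ, 0 < x → HasDerivAt secondDiff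
      (Real.log (x + 2) - 2 * Real.log (x + 1) + Real.log x) x := by
    intro x hx
    have i := hasDerivAt_id' x
    have h1 := hasDerivAt_mul_log_comp (i.add_const 2) (by linarith)
    have h2 := hasDerivAt_mul_log_comp (i.add_const 1) (by linarith)
    have h3 := hasDerivAt_mul_log_comp i hx
    exact ((h1.sub (h2.const_mul 2)).add h3).congr_deriv (by ring)
  refine strictAntiOn_of_deriv_neg (convex_Ioi 0)
    (fun x hx => (hder x hx).continuousAt.continuousWithinAt) fun x hx => ?_
  have hx0 : 0 < x := interior_subset hx
  rw [(hder x hx0).deriv]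
  have hlog := Real.log_lt_log (show 0 < (x + 2) * x by positivity)
    (show (x + 2) * x < (x + 1) ^ 2 by nlinarith)
  rw [Real.log_mul (by positivity) (by positivity), Real.log_pow] at hlog
  push_cast at hlog
  linarith

/-- For K_3 the gap is `secondDiff (c + 1) - secondDiff c`. -/
theorem starGap_K_three_neg {c : ℝ} (hc : 0 < c) {G : SimpleGraph V}
    (e : EqUpToIsolated G (K 3)) : starGap c G < 0 := by
  have h1 := secondDiff_strictAntiOn (show c ∈ Set.Ioi 0 from hc)
    (show c + 1 ∈ Set.Ioi 0 from by simp; linarith) (by linarith)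
  rw [starGap, e.degSum_eq (by simp), e.size_eq, size_K_three, degSum_K]
  unfold secondDiff at h1
  norm_num [f] at h1 ⊢
  ring_nf at h1 ⊢
  linarith

theorem starGap_star {c : ℝ} {m : ℕ} {G : SimpleGraph V} (e : EqUpToIsolated G (star m)) :
    starGap c G = 0 := by
  rw [starGap, e.degSum_eq (by simp), e.size_eq, size_star, degSum_star]
  simp

theorem h_le_h_iff_starGap {c : ℝ} {G H : SimpleGraph V} (hs : size G = size H) :
    h c H ≤ h c G ↔ starGap c G ≤ starGap c H := by
  rw [h_eq_add_card, h_eq_add_card, starGap, starGap, hs]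
  constructor <;> intro h <;> linarith

theorem starGap_eq_of_K_three {W : Type u} [Fintype W] {c : ℝ} {G : SimpleGraph V}
    {H : SimpleGraph W} (hG : EqUpToIsolated G (K 3)) (hH : EqUpToIsolated H (K 3)) :
    starGap c G = starGap c H := by
  rw [starGap, starGap, hG.degSum_eq (by simp), hH.degSum_eq (by simp), hG.size_eq, hH.size_eq]

theorem exists_eqUpToIsolated {W : Type*} [Fintype W] (H : SimpleGraph W)
    (hcard : Fintype.card W ≤ Fintype.card V) : ∃ G : SimpleGraph V, EqUpToIsolated G H := by
  obtain ⟨e⟩ := Function.Embedding.nonempty_of_card_le hcard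
  exact ⟨H.map e, eqUpToIsolated_map H e⟩

theorem maximizesGivenOrderAndSize_iff_star {c m : ℕ} (hc : 2 ≤ c) (hm : m < Fintype.card V)
    (hm3 : m ≠ 3) (G : SimpleGraph V) :
    MaximizesGivenOrderAndSize c m G ↔ EqUpToIsolated G (star m) := by
  constructor
  · rintro ⟨hG, hmax⟩
    -- The star has m + 1 vertices, so m < |V| is exactly what lets it fit.
    obtain ⟨H, hH⟩ := exists_eqUpToIsolated (V := V) (star m) (by simp; omega)
    have hHs : size H = m := hH.size_eq.trans (size_star m)
    have hle := (h_le_h_iff_starGap (hG.trans hHs.symm)).1 (hmax H hHs)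
    rw [starGap_star hH] at hle
    rcases starGap_classification hc G with e | e | ⟨e, -⟩
    · rwa [hG] at e
    · linarith
    · omega
  · intro hG
    have hGs : size G = m := hG.size_eq.trans (size_star m)
    refine ⟨hGs, fun H hH => (h_le_h_iff_starGap (hGs.trans hH.symm)).2 ?_⟩
    rw [starGap_star hG]
    rcases starGap_classification hc H with e | e | ⟨e, -⟩
    · exact (starGap_star e).ge
    · exact e.le
    · omega

theorem maximizesGivenOrderAndSize_iff_K_three {c : ℕ} (hc : 2 ≤ c) (hm : 3 < Fintype.card V)
    (G : SimpleGraph V) :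
    MaximizesGivenOrderAndSize c 3 G ↔ EqUpToIsolated G (K 3) := by
  have hc0 : (0 : ℝ) < c := by exact_mod_cast (by omega : 0 < c)
  constructor
  · rintro ⟨hG, hmax⟩
    obtain ⟨H, hH⟩ := exists_eqUpToIsolated (V := V) (K 3) (by simp; omega)
    have hHs : size H = 3 := hH.size_eq.trans size_K_three
    have hle := (h_le_h_iff_starGap (hG.trans hHs.symm)).1 (hmax H hHs)
    have hneg := starGap_K_three_neg hc0 hH
    rcases starGap_classification hc G with e | e | ⟨-, e⟩
    · rw [starGap_star e] at hle
      linarith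
    · linarith
    · exact e
  · intro hG
    have hGs : size G = 3 := hG.size_eq.trans size_K_three
    refine ⟨hGs, fun H hH => (h_le_h_iff_starGap (hGs.trans hH.symm)).2 ?_⟩
    have hneg := starGap_K_three_neg hc0 hG
    rcases starGap_classification hc H with e | e | ⟨-, e⟩
    · rw [starGap_star e]
      exact hneg.le
    · linarith
    · exact (starGap_eq_of_K_three hG e).le

/-- A maximizer of `h_1` of given size is compared with graphs in any universe. -/
theorem MaximizesGivenSize.exists_eqUpToIsolated {m : ℕ} {G : SimpleGraph V}
    (hG : MaximizesGivenSize 1 m G) {W : Type} [Fintype W] (H : SimpleGraph W) (hH : size H = m) :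
    ∃ (W' : Type u) (_ : Fintype W') (H' : SimpleGraph W'),
      EqUpToIsolated H' H ∧ h 1 H' ≤ h 1 G := by
  have e := eqUpToIsolated_map H (Equiv.ulift.{u}.symm.toEmbedding)
  exact ⟨ULift.{u} W, inferInstance, _, e, hG.2 _ _ (e.size_eq.trans hH)⟩

theorem maximizesGivenSize_iff_star {m : ℕ} (h3 : m ≠ 3) (h5 : m ≠ 5) (h6 : m ≠ 6)
    (G : SimpleGraph V) : MaximizesGivenSize 1 m G ↔ EqUpToIsolated G (star m) := by
  constructor
  · intro hG
    obtain ⟨W, _, H, e, hle⟩ := hG.exists_eqUpToIsolated (star m) (size_star m)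
    rw [e.h_one_star] at hle
    rcases h_one_classification m G hG.1 with e | e | e | e | e
    · exact e
    · linarith
    all_goals omega
  · intro hG
    refine ⟨hG.size_eq.trans (size_star m), fun W _ H hH => ?_⟩
    rw [hG.h_one_star]
    rcases h_one_classification m H hH with e | e | e | e | e
    · exact e.h_one_star.le
    · exact e.le
    all_goals omega

theorem maximizesGivenSize_iff_K_three (G : SimpleGraph V) :
    MaximizesGivenSize 1 3 G ↔ EqUpToIsolated G (K 3) := by
  have hlt := starValue_three_lt
  constructor
  · intro hG
    obtain ⟨W, _, H, e, hle⟩ := hG.exists_eqUpToIsolated (K 3) size_K_three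
    rw [e.h_one_K_three] at hle
    rcases h_one_classification 3 G hG.1 with e | e | e | e | e
    · rw [e.h_one_star] at hle
      linarith
    · linarith
    · exact e.2
    all_goals omega
  · intro hG
    refine ⟨hG.size_eq.trans size_K_three, fun W _ H hH => ?_⟩
    rw [hG.h_one_K_three]
    rcases h_one_classification 3 H hH with e | e | e | e | e
    · rw [e.h_one_star]
      exact hlt.le
    · linarith
    · exact e.2.h_one_K_three.le
    all_goals omega

theorem maximizesGivenSize_iff_K4minus_or_star (G : SimpleGraph V) :
    MaximizesGivenSize 1 5 G ↔ EqUpToIsolated G K4minus ∨ EqUpToIsolated G (star 5) := by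
  constructor
  · intro hG
    obtain ⟨W, _, H, e, hle⟩ := hG.exists_eqUpToIsolated (star 5) (size_star 5)
    rw [e.h_one_star] at hle
    rcases h_one_classification 5 G hG.1 with e | e | e | e | e
    · exact Or.inr e
    · linarith
    · omega
    · exact Or.inl e.2
    · omega
  · intro hG
    have hval : size G = 5 ∧ h 1 G = starValue 5 := by
      rcases hG with e | e
      · exact ⟨e.size_eq.trans size_K4minus, e.h_one_K4minus⟩
      · exact ⟨e.size_eq.trans (size_star 5), e.h_one_star⟩
    refine ⟨hval.1, fun W _ H hH => ?_⟩
    rw [hval.2]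
    rcases h_one_classification 5 H hH with e | e | e | e | e
    · exact e.h_one_star.le
    · exact e.le
    · omega
    · exact e.2.h_one_K4minus.le
    · omega

theorem maximizesGivenSize_iff_K_four (G : SimpleGraph V) :
    MaximizesGivenSize 1 6 G ↔ EqUpToIsolated G (K 4) := by
  have hlt := starValue_six_lt
  constructor
  · intro hG
    obtain ⟨W, _, H, e, hle⟩ := hG.exists_eqUpToIsolated (K 4) size_K_four
    rw [e.h_one_K_four] at hle
    rcases h_one_classification 6 G hG.1 with e | e | e | e | e
    · rw [e.h_one_star] at hle
      linarith
    · linarith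
    · omega
    · omega
    · exact e.2
  · intro hG
    refine ⟨hG.size_eq.trans size_K_four, fun W _ H hH => ?_⟩
    rw [hG.h_one_K_four]
    rcases h_one_classification 6 H hH with e | e | e | e | e
    · rw [e.h_one_star]
      exact hlt.le
    · linarith
    · omega
    · omega
    · exact e.2.h_one_K_four.le

end DegreeEntropy

theorem theorem3p1 (m : ℕ) (V : Type*) [Fintype V] (G : SimpleGraph V) :
    ((m ≠ 3 → m ≠ 5 → m ≠ 6 →
        (DegreeEntropy.MaximizesGivenSize 1 m G ↔
          DegreeEntropy.EqUpToIsolated G (DegreeEntropy.star m))) ∧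
      (m = 3 →
        (DegreeEntropy.MaximizesGivenSize 1 m G ↔
          DegreeEntropy.EqUpToIsolated G (DegreeEntropy.K 3))) ∧
      (m = 5 →
        (DegreeEntropy.MaximizesGivenSize 1 m G ↔
          DegreeEntropy.EqUpToIsolated G DegreeEntropy.K4minus ∨
            DegreeEntropy.EqUpToIsolated G (DegreeEntropy.star 5))) ∧
      (m = 6 →
        (DegreeEntropy.MaximizesGivenSize 1 m G ↔
          DegreeEntropy.EqUpToIsolated G (DegreeEntropy.K 4)))) ∧
    (∀ c : ℕ, 2 ≤ c → m < Fintype.card V →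
      (m ≠ 3 →
        (DegreeEntropy.MaximizesGivenOrderAndSize c m G ↔
          DegreeEntropy.EqUpToIsolated G (DegreeEntropy.star m))) ∧
      (m = 3 →
        (DegreeEntropy.MaximizesGivenOrderAndSize c m G ↔
          DegreeEntropy.EqUpToIsolated G (DegreeEntropy.K 3)))) := by
  refine ⟨⟨fun h3 h5 h6 => DegreeEntropy.maximizesGivenSize_iff_star h3 h5 h6 G, ?_, ?_, ?_⟩,
    fun c hc hm =>
      ⟨fun h3 => DegreeEntropy.maximizesGivenOrderAndSize_iff_star hc hm h3 G, ?_⟩⟩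
  · rintro rfl
    exact DegreeEntropy.maximizesGivenSize_iff_K_three G
  · rintro rfl
    exact DegreeEntropy.maximizesGivenSize_iff_K4minus_or_star G
  · rintro rfl
    exact DegreeEntropy.maximizesGivenSize_iff_K_four G
  · rintro rfl
    exact DegreeEntropy.maximizesGivenOrderAndSize_iff_K_three hc hm G
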